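/- Let $n\ge 0$, and on $\mathbb C^{2n}=\{(P,Q):P,Q\in\mathbb C^n\}$ let $\omega((P,Q),(P',Q'))=\sum_{j}(P_jQ_j'-P_j'Q_j)$ (complex bilinear), and let $*$ denote entrywise complex conjugation. Let $\mathcal L_k\subset\mathbb R^{2n}$ be a $k$-dimensional real subspace that is isotropic for $\omega$, let $\mathcal L_k^{\mathbb C}\subset\mathbb C^{2n}$ be its complexification, let $W^{\perp\omega}=\{Y:\omega(Y,X)=0\ \forall X\in W\}$, and let $\mu$ be a Haar (translation-invariant) measure on $\mathcal L_k$. For $Y=(P,Q)\in\mathbb C^{2n}$ put $\Omega(Y)=\sum_j\big(P_j\xi_j-Q_j\frac1i\frac{\partial}{\partial\xi_j}\big)$, acting on the Schwartz space $\mathcal S(\mathbb R^n)$; for real $X=(P,Q)$ one has $(e^{i\Omega(X)}\psi)(\xi)=e^{iP\cdot\xi-\frac i2P\cdot Q}\psi(\xi-Q)$. For $f,g\in\mathcal S(\mathbb R^n)$ put $$\langle f,g\rangle=\int_{\mathcal L_k}d\mu(X)\int_{\mathbb R^n}d\xi\,\overline{f(\xi)}\,(e^{i\Omega(X)}g)(\xi),\qquad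 \|f\|^2=\langle f,f\rangle .$$ The H-germ of $\psi\in\mathcal S(\mathbb R^n)$ is $\{Y\in(\mathcal L_k^{\mathbb C})^{\perp\omega}:\ \|\Omega(Y)\psi\|=0\}$. Let $\check r\subset\mathbb C^{2n}$ be a complex subspace of dimension $n$ such that 1. $\omega(Y_1,Y_2)=0$ for all $Y_1,Y_2\in\check r$; 2. every $Y\in\mathcal L_k^{\mathbb C}$ satisfies $Y\in\check r$ and $\omega(Y,Y^*)=0$; 3. $\frac1i\,\omega(Y,Y^*)>0$ for every $Y\in\check r\setminus\mathcal L_k^{\mathbb C}$. Then $$(\mathcal L_k^{\mathbb C})^{\perp\omega}=\check r+\check r^*,\qquad \check r\cap\check r^*=\mathcal L_k^{\mathbb C},$$ and there is a symmetric complex $n\times n$ matrix $A$ with positive definite imaginary part such that, for every constant $c\ne0$, the Gaussian function $\psi_A(\xi)=c\exp\big(\frac i2\sum_{j,l}\xi_jA_{jl}\xi_l\big)$ belongs to $\mathcal S(\mathbb R^n)$ and has H-germ $\check r(A)=\check r$. -/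

import Mathlib

open scoped SchwartzMap

noncomputable section

/-- Pairs `(P, Q)` of momenta and coordinates: `Phase n ℝ` is the phase space `ℝ²ⁿ`,
`Phase n ℂ` is its complexification. -/
abbrev Phase (n : ℕ) (𝕜 : Type) : Type := (Fin n → 𝕜) × (Fin n → 𝕜)

/-- The symplectic form `ω((P,Q),(P',Q')) = ∑ j, (P j * Q' j - P' j * Q j)`; over `ℂ` it is
complex bilinear. -/
def symplForm {n : ℕ} {𝕜 : Type} [CommRing 𝕜] (X X' : Phase n 𝕜) : 𝕜 :=
  ∑ j, (X.1 j * X'.2 j - X'.1 j * X.2 j)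

/-- The inclusion `ℝ²ⁿ → ℂ²ⁿ`. -/
def Phase.toComplex {n : ℕ} (X : Phase n ℝ) : Phase n ℂ :=
  (fun j => (X.1 j : ℂ), fun j => (X.2 j : ℂ))

/-- The complexification `L^ℂ ⊆ ℂ²ⁿ` of a real subspace `L ⊆ ℝ²ⁿ`. -/
def complexify {n : ℕ} (L : Submodule ℝ (Phase n ℝ)) : Submodule ℂ (Phase n ℂ) :=
  Submodule.span ℂ (Phase.toComplex '' (L : Set (Phase n ℝ)))

/-- The skew-orthogonal complement `W^{⊥ω}` of a complex subspace `W`. -/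
def skewOrth {n : ℕ} (W : Submodule ℂ (Phase n ℂ)) : Submodule ℂ (Phase n ℂ) where
  carrier := {Y | ∀ X ∈ W, symplForm Y X = 0}
  zero_mem' := by
    intro X _
    simp [symplForm]
  add_mem' := by
    intro Y Z hY hZ X hX
    have h : symplForm (Y + Z) X = symplForm Y X + symplForm Z X := by
      simp only [symplForm, ← Finset.sum_add_distrib]
      exact Finset.sum_congr rfl fun j _ => by simp; ring
    rw [h, hY X hX, hZ X hX, add_zero]
  smul_mem' := by
    intro c Y hY X hX
    have h : symplForm (c • Y) X = c * symplForm Y X := by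
      simp only [symplForm, Finset.mul_sum]
      exact Finset.sum_congr rfl fun j _ => by simp; ring
    rw [h, hY X hX, mul_zero]

/-- The complex conjugate `r^* = {Y^* | Y ∈ r}` of a complex subspace; conjugation `star` is
entrywise and involutive, so membership `Y ∈ r^*` is written `Y^* ∈ r`. -/
def conjSubspace {n : ℕ} (r : Submodule ℂ (Phase n ℂ)) : Submodule ℂ (Phase n ℂ) where
  carrier := {Y | star Y ∈ r}
  zero_mem' := by
    simp
  add_mem' := by
    intro Y Z hY hZ
    simpa using r.add_mem hY hZ
  smul_mem' := by
    intro c Y hY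
    simpa using r.smul_mem (star c) hY

/-- The operator `Ω(P,Q) = ∑ j, (P j * ξ j - Q j * (1/i) * ∂/∂ξ j)` applied to a wave function. -/
def OmegaOp {n : ℕ} (Y : Phase n ℂ) (ψ : (Fin n → ℝ) → ℂ) : (Fin n → ℝ) → ℂ := fun ξ =>
  ∑ j, (Y.1 j * (ξ j : ℂ) * ψ ξ
    - Y.2 j * ((1 / Complex.I) * fderiv ℝ ψ ξ (Pi.single j 1)))

/-- The Weyl operator `e^{iΩ(X)}` for real `X = (P,Q)`:
`(e^{iΩ(X)} ψ)(ξ) = e^{i P·ξ - (i/2) P·Q} ψ(ξ - Q)`. -/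
def weyl {n : ℕ} (X : Phase n ℝ) (ψ : (Fin n → ℝ) → ℂ) : (Fin n → ℝ) → ℂ := fun ξ =>
  Complex.exp (Complex.I * ((∑ j, X.1 j * ξ j - (1 / 2) * ∑ j, X.1 j * X.2 j : ℝ) : ℂ))
    * ψ (ξ - X.2)

/-- The inner product `⟨f, g⟩ = ∫_{L} dμ(X) (f, e^{iΩ(X)} g)`, where
`(f, g) = ∫ conj (f ξ) * g ξ dξ` is the inner product of `L²(ℝⁿ)`. -/
def constraintInner {n : ℕ} (L : Submodule ℝ (Phase n ℝ)) (μ : MeasureTheory.Measure L)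
    (f g : (Fin n → ℝ) → ℂ) : ℂ :=
  ∫ X : L, (∫ ξ : Fin n → ℝ, star (f ξ) * weyl (X : Phase n ℝ) g ξ) ∂μ

/-- The H-germ of a state `ψ`: the vectors `Y` skew-orthogonal to the constraint plane (those for
which `Ω(Y)` is an operator on equivalence classes of states) such that `Ω(Y) ψ` is a zero-norm
state. -/
def hGerm {n : ℕ} (L : Submodule ℝ (Phase n ℝ)) (μ : MeasureTheory.Measure L)
    (ψ : 𝓢(Fin n → ℝ, ℂ)) : Set (Phase n ℂ) :=
  {Y | Y ∈ skewOrth (complexify L) ∧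
    constraintInner L μ (OmegaOp Y ψ) (OmegaOp Y ψ) = 0}

/-- The Gaussian wave function `c * exp((i/2) ∑ j k, ξ j * A j k * ξ k)`. -/
def gaussian {n : ℕ} (A : Matrix (Fin n) (Fin n) ℂ) (c : ℂ) : (Fin n → ℝ) → ℂ := fun ξ =>
  c * Complex.exp ((Complex.I / 2) * ∑ j, ∑ k, (ξ j : ℂ) * A j k * (ξ k : ℂ))

end

/-!
Write `C` for the complexification of `L`. Tilting the vectors `X ∈ C` to `X - i J X`, where `J` is
the standard complex structure, turns `r` into a Lagrangian subspace `R` on which `(1/i) ω(Y, Y*)`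
is positive definite, with `r ⊆ C + R`. Such an `R` is the graph `P = A Q` of a symmetric matrix `A`
with positive definite imaginary part, and this graph equation says exactly that every `Ω(Y)` with
`Y ∈ R` annihilates the Gaussian `ψ_A`.

For the inner product over `L`, the vectors `Ω(X) g` with `X ∈ C` are orthogonal to everything,
since `(f, e^{iΩ(X')} Ω(X) g)` is a derivative along `L`; and `Ω(Y*)` is the adjoint of `Ω(Y)` when
`Y` is skew-orthogonal to `C`. Hence `Ω(Y) ψ_A` is null for `Y ∈ r`. Conversely, modulo `r` a vector
skew-orthogonal to `C` is `X + W*` with `X ∈ C` and `W ∈ r ∩ R`, and the commutator of `Ω(W)` and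
`Ω(W*)` gives `‖Ω(X + W*) ψ_A‖² = (1/i) ω(W, W*) ‖ψ_A‖²`, which vanishes only for `W ∈ C`.

Finally `‖ψ_A‖² > 0` because the integrand over `L` is positive: writing `X = b + b*` with `b ∈ R`,
the function `φ(t) = (ψ_A, e^{iΩ(tX)} ψ_A)` satisfies `φ' = i ω(b, b*) t φ` with real coefficient
`i ω(b, b*)` and `φ(0) > 0`.
-/

section SymplecticAlgebra

open scoped ComplexOrder Matrix

variable {n : ℕ}

theorem symplForm_eq_dotProduct {𝕜 : Type} [CommRing 𝕜] (X Y : Phase n 𝕜) :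
    symplForm X Y = X.1 ⬝ᵥ Y.2 - Y.1 ⬝ᵥ X.2 := by
  simp [symplForm, dotProduct, Finset.sum_sub_distrib]

theorem symplForm_self {𝕜 : Type} [CommRing 𝕜] (X : Phase n 𝕜) : symplForm X X = 0 := by
  simp [symplForm]

theorem symplForm_smul_right {𝕜 : Type} [CommRing 𝕜] (c : 𝕜) (X Y : Phase n 𝕜) :
    symplForm X (c • Y) = c * symplForm X Y := by
  simp only [symplForm_eq_dotProduct, Prod.smul_fst, Prod.smul_snd, dotProduct_smul,
    smul_dotProduct, smul_eq_mul, mul_sub]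

/-- The symplectic form on `ℂ²ⁿ` as a bilinear form. -/
def symplBilin (n : ℕ) : LinearMap.BilinForm ℂ (Phase n ℂ) :=
  LinearMap.mk₂ ℂ symplForm
    (fun X X' Y => by
      simp only [symplForm_eq_dotProduct, Prod.fst_add, Prod.snd_add, add_dotProduct,
        dotProduct_add]
      ring)
    (fun c X Y => by
      simp only [symplForm_eq_dotProduct, Prod.smul_fst, Prod.smul_snd, dotProduct_smul,
        smul_dotProduct, smul_sub])
    (fun X Y Y' => by
      simp only [symplForm_eq_dotProduct, Prod.fst_add, Prod.snd_add, add_dotProduct,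
        dotProduct_add]
      ring)
    (fun c X Y => symplForm_smul_right c X Y)

theorem symplBilin_apply (X Y : Phase n ℂ) : symplBilin n X Y = symplForm X Y := rfl

theorem symplBilin_swap (X Y : Phase n ℂ) : symplBilin n X Y = -symplBilin n Y X := by
  simp [symplBilin_apply, symplForm_eq_dotProduct]

theorem star_symplBilin (X Y : Phase n ℂ) :
    star (symplBilin n X Y) = symplBilin n (star X) (star Y) := by
  simp [symplBilin_apply, symplForm]

/-- The complex structure `J (P, Q) = (-Q, P)`. -/
def phaseRot (n : ℕ) : Phase n ℂ →ₗ[ℂ] Phase n ℂ :=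
  (-LinearMap.snd ℂ _ _).prod (LinearMap.fst ℂ _ _)

/-- The dot product `ω(X, J Y)` on `ℂ²ⁿ`, complex bilinear. -/
def phaseDot (n : ℕ) : LinearMap.BilinForm ℂ (Phase n ℂ) :=
  (symplBilin n).compRight (phaseRot n)

theorem symplBilin_phaseRot_right (X Y : Phase n ℂ) :
    symplBilin n X (phaseRot n Y) = phaseDot n X Y := rfl

theorem phaseDot_eq_dotProduct (X Y : Phase n ℂ) :
    phaseDot n X Y = X.1 ⬝ᵥ Y.1 + X.2 ⬝ᵥ Y.2 := by
  rw [← symplBilin_phaseRot_right, symplBilin_apply, symplForm_eq_dotProduct]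
  simp [phaseRot, dotProduct_comm]

theorem phaseDot_comm (X Y : Phase n ℂ) : phaseDot n X Y = phaseDot n Y X := by
  simp [phaseDot_eq_dotProduct, dotProduct_comm]

theorem symplBilin_phaseRot_left (X Y : Phase n ℂ) :
    symplBilin n (phaseRot n X) Y = -phaseDot n X Y := by
  rw [symplBilin_swap, symplBilin_phaseRot_right, phaseDot_comm]

theorem phaseDot_phaseRot_left (X Y : Phase n ℂ) :
    phaseDot n (phaseRot n X) Y = symplBilin n X Y := by
  rw [phaseDot_eq_dotProduct, symplBilin_apply, symplForm_eq_dotProduct]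
  simp only [phaseRot, LinearMap.prod_apply, Function.prod, LinearMap.neg_apply,
    LinearMap.snd_apply, LinearMap.fst_apply, neg_dotProduct, dotProduct_comm X.2]
  ring

theorem star_phaseRot (X : Phase n ℂ) : star (phaseRot n X) = phaseRot n (star X) := by
  ext <;> simp [phaseRot]

theorem phaseDot_star_self_nonneg (X : Phase n ℂ) : 0 ≤ phaseDot n X (star X) := by
  rw [phaseDot_eq_dotProduct]
  exact add_nonneg (dotProduct_self_star_nonneg _) (dotProduct_self_star_nonneg _)

theorem phaseDot_star_self_eq_zero {X : Phase n ℂ} : phaseDot n X (star X) = 0 ↔ X = 0 := by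
  rw [phaseDot_eq_dotProduct, Prod.fst_star, Prod.snd_star, add_eq_zero_iff_of_nonneg
    (dotProduct_self_star_nonneg _) (dotProduct_self_star_nonneg _),
    dotProduct_self_star_eq_zero, dotProduct_self_star_eq_zero, Prod.ext_iff]
  rfl

theorem phaseDot_star_self_pos {X : Phase n ℂ} (hX : X ≠ 0) : 0 < phaseDot n X (star X) :=
  (phaseDot_star_self_nonneg X).lt_of_ne' (mt phaseDot_star_self_eq_zero.1 hX)

theorem symplBilin_nondegenerate : (symplBilin n).Nondegenerate := by
  have hleft : ∀ X, (∀ Y, symplBilin n X Y = 0) → X = 0 := fun X hX =>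
    phaseDot_star_self_eq_zero.1 (hX _)
  exact ⟨hleft, fun X hX => hleft X fun Y => by rw [symplBilin_swap, hX, neg_zero]⟩

theorem symplBilin_isRefl : (symplBilin n).IsRefl := fun X Y h => by
  rw [symplBilin_swap, h, neg_zero]

theorem orthogonal_symplBilin (W : Submodule ℂ (Phase n ℂ)) :
    (symplBilin n).orthogonal W = skewOrth W := by
  ext Y
  rw [LinearMap.BilinForm.mem_orthogonal_iff]
  refine forall₂_congr fun X _ => ?_
  rw [symplBilin_swap, neg_eq_zero, symplBilin_apply]

theorem skewOrth_skewOrth (W : Submodule ℂ (Phase n ℂ)) : skewOrth (skewOrth W) = W := by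
  simp only [← orthogonal_symplBilin]
  exact LinearMap.BilinForm.orthogonal_orthogonal symplBilin_nondegenerate symplBilin_isRefl W

theorem skewOrth_sup (U W : Submodule ℂ (Phase n ℂ)) :
    skewOrth (U ⊔ W) = skewOrth U ⊓ skewOrth W := by
  ext Y
  refine ⟨fun h => ⟨fun X hX => h X (Submodule.mem_sup_left hX),
    fun X hX => h X (Submodule.mem_sup_right hX)⟩, fun ⟨hU, hW⟩ X hX => ?_⟩
  obtain ⟨u, hu, w, hw, rfl⟩ := Submodule.mem_sup.1 hX
  rw [← symplBilin_apply, map_add, symplBilin_apply, symplBilin_apply, hU u hu, hW w hw, add_zero]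

theorem skewOrth_inf (U W : Submodule ℂ (Phase n ℂ)) :
    skewOrth (U ⊓ W) = skewOrth U ⊔ skewOrth W := by
  rw [← skewOrth_skewOrth (skewOrth U ⊔ skewOrth W), skewOrth_sup, skewOrth_skewOrth,
    skewOrth_skewOrth]

theorem skewOrth_conjSubspace (W : Submodule ℂ (Phase n ℂ)) :
    skewOrth (conjSubspace W) = conjSubspace (skewOrth W) := by
  have hstar : ∀ X Y : Phase n ℂ, symplBilin n (star Y) X = 0 ↔ symplBilin n Y (star X) = 0 :=
    fun X Y => by rw [← star_eq_zero, star_symplBilin, star_star]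
  ext Y
  refine ⟨fun h X hX => (hstar X Y).2 (h _ ?_), fun h X hX => ?_⟩
  · rwa [← star_star X] at hX
  · simpa [symplBilin_apply] using (hstar (star X) Y).1 (h _ hX)

end SymplecticAlgebra

section Lagrangian

open scoped ComplexOrder Matrix

variable {n : ℕ}

/-- A Lagrangian subspace of `ℂ²ⁿ`: one that is its own skew-orthogonal complement. -/
def IsLagrangian (W : Submodule ℂ (Phase n ℂ)) : Prop := skewOrth W = W

/-- A subspace of `ℂ²ⁿ` on which the Hermitian form `(1/i) ω(Y, Y*)` is positive definite. -/
def IsPositive (W : Submodule ℂ (Phase n ℂ)) : Prop :=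
  ∀ Y ∈ W, Y ≠ 0 → 0 < (1 / Complex.I) * symplForm Y (star Y)

theorem finrank_skewOrth (W : Submodule ℂ (Phase n ℂ)) :
    Module.finrank ℂ (skewOrth W) = n + n - Module.finrank ℂ W := by
  rw [← orthogonal_symplBilin, LinearMap.BilinForm.finrank_orthogonal symplBilin_nondegenerate,
    Module.finrank_prod, Module.finrank_fin_fun]

theorem isLagrangian_of_finrank_eq {W : Submodule ℂ (Phase n ℂ)} (hdim : Module.finrank ℂ W = n)
    (hiso : ∀ Y₁ ∈ W, ∀ Y₂ ∈ W, symplForm Y₁ Y₂ = 0) : IsLagrangian W :=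
  (Submodule.eq_of_le_of_finrank_eq (S₂ := skewOrth W) (fun Y hY X hX => hiso Y hY X hX)
    (by rw [finrank_skewOrth, hdim, Nat.add_sub_cancel])).symm

namespace IsLagrangian

variable {W : Submodule ℂ (Phase n ℂ)}

theorem symplForm_eq_zero (hW : IsLagrangian W) {X Y : Phase n ℂ} (hX : X ∈ W) (hY : Y ∈ W) :
    symplForm X Y = 0 := by
  rw [← hW] at hX
  exact hX Y hY

theorem finrank_eq (hW : IsLagrangian W) : Module.finrank ℂ W = n := by
  have hdim := finrank_skewOrth W
  rw [hW] at hdim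
  have hle : Module.finrank ℂ W ≤ n + n := by
    simpa using Submodule.finrank_le W
  omega

theorem skewOrth_inf_conjSubspace (hW : IsLagrangian W) :
    skewOrth (W ⊓ conjSubspace W) = W ⊔ conjSubspace W := by
  rw [skewOrth_inf, skewOrth_conjSubspace, hW]

theorem inf_conjSubspace_le (hW : IsLagrangian W) {C : Submodule ℂ (Phase n ℂ)}
    (hpos : ∀ Y ∈ W, Y ∉ C → 0 < (1 / Complex.I) * symplForm Y (star Y)) :
    W ⊓ conjSubspace W ≤ C := by
  rintro Y ⟨hY, hY'⟩
  by_contra hC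
  have hlt := hpos Y hY hC
  rw [hW.symplForm_eq_zero hY hY', mul_zero] at hlt
  exact lt_irrefl _ hlt

theorem sup_conjSubspace_eq_top (hW : IsLagrangian W) (hpos : IsPositive W) :
    W ⊔ conjSubspace W = ⊤ := by
  have hbot : W ⊓ conjSubspace W = ⊥ := le_bot_iff.1 (hW.inf_conjSubspace_le hpos)
  rw [← hW.skewOrth_inf_conjSubspace, hbot, eq_top_iff]
  intro Y _ X hX
  rw [(Submodule.mem_bot ℂ).1 hX, ← symplBilin_apply, map_zero]

end IsLagrangian

/-- The graph `{(P, Q) | P = A Q}` of a matrix as a subspace of `ℂ²ⁿ`. -/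
def matrixGraph (A : Matrix (Fin n) (Fin n) ℂ) : Submodule ℂ (Phase n ℂ) :=
  LinearMap.eqLocus (LinearMap.fst ℂ _ _) (A.mulVecLin ∘ₗ LinearMap.snd ℂ _ _)

theorem mem_matrixGraph {A : Matrix (Fin n) (Fin n) ℂ} {Y : Phase n ℂ} :
    Y ∈ matrixGraph A ↔ Y.1 = A *ᵥ Y.2 := Iff.rfl

theorem exists_eq_matrixGraph {R : Submodule ℂ (Phase n ℂ)} (hdim : Module.finrank ℂ R = n)
    (hinj : ∀ Y ∈ R, Y.2 = 0 → Y = 0) : ∃ A : Matrix (Fin n) (Fin n) ℂ, R = matrixGraph A := by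
  let snd : R →ₗ[ℂ] (Fin n → ℂ) := LinearMap.snd ℂ _ _ ∘ₗ R.subtype
  have hsnd : Function.Injective snd :=
    (injective_iff_map_eq_zero snd).2 fun Y hY => Subtype.ext (hinj Y Y.2 hY)
  let e : R ≃ₗ[ℂ] (Fin n → ℂ) := LinearEquiv.ofInjectiveOfFinrankEq snd hsnd (by simp [hdim])
  have he : ∀ q, (e.symm q : Phase n ℂ).2 = q := e.apply_symm_apply
  refine ⟨LinearMap.toMatrix' (LinearMap.fst ℂ _ _ ∘ₗ R.subtype ∘ₗ e.symm.toLinearMap), ?_⟩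
  ext Y
  rw [mem_matrixGraph, LinearMap.toMatrix'_mulVec]
  refine ⟨fun hY => ?_, fun hY => ?_⟩
  · exact congrArg (fun Z : R => (Z : Phase n ℂ).1) (e.symm_apply_apply ⟨Y, hY⟩).symm
  · rw [show Y = e.symm Y.2 from Prod.ext hY (he Y.2).symm]
    exact (e.symm Y.2).2

theorem isSymm_of_isLagrangian_matrixGraph {A : Matrix (Fin n) (Fin n) ℂ}
    (hA : IsLagrangian (matrixGraph A)) : A.IsSymm := by
  ext i j
  have hij := hA.symplForm_eq_zero (X := (A *ᵥ Pi.single i 1, Pi.single i 1))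
    (Y := (A *ᵥ Pi.single j 1, Pi.single j 1)) rfl rfl
  simpa [symplForm_eq_dotProduct, sub_eq_zero] using hij

theorem symplForm_mulVec_ofReal_star (A : Matrix (Fin n) (Fin n) ℂ) (q : Fin n → ℝ) :
    (1 / Complex.I) * symplForm (A *ᵥ (Complex.ofReal ∘ q), Complex.ofReal ∘ q)
        (star (A *ᵥ (Complex.ofReal ∘ q), Complex.ofReal ∘ q))
      = (2 * (q ⬝ᵥ A.map Complex.im *ᵥ q) : ℝ) := by
  have hsub : ∀ z : ℂ, (1 / Complex.I) * (z - star z) = (2 * z.im : ℝ) := fun z => by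
    rw [Complex.star_def, Complex.sub_conj]
    push_cast
    field_simp
  have hreal : star (Complex.ofReal ∘ q) = Complex.ofReal ∘ q := by
    ext j
    simp
  have him : ((A *ᵥ (Complex.ofReal ∘ q)) ⬝ᵥ (Complex.ofReal ∘ q)).im
      = q ⬝ᵥ A.map Complex.im *ᵥ q := by
    simp [dotProduct, Matrix.mulVec, mul_comm]
  rw [symplForm_eq_dotProduct, Prod.fst_star, Prod.snd_star, hreal, ← him, ← hsub,
    Matrix.star_dotProduct, hreal, dotProduct_comm (Complex.ofReal ∘ q)]

theorem posDef_of_isPositive_matrixGraph {A : Matrix (Fin n) (Fin n) ℂ} (hA : A.IsSymm)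
    (hpos : IsPositive (matrixGraph A)) : (A.map Complex.im).PosDef := by
  refine Matrix.PosDef.of_dotProduct_mulVec_pos ?_ fun q hq => ?_
  · ext i j
    simp [hA.apply i j]
  · have hlt := hpos (A *ᵥ (Complex.ofReal ∘ q), Complex.ofReal ∘ q) rfl fun h0 => hq <|
      funext fun j => Complex.ofReal_injective (congrFun (congrArg Prod.snd h0) j)
    rw [symplForm_mulVec_ofReal_star] at hlt
    simpa using hlt

theorem exists_matrix_of_isPositive {R : Submodule ℂ (Phase n ℂ)} (hR : IsLagrangian R)
    (hpos : IsPositive R) : ∃ A : Matrix (Fin n) (Fin n) ℂ,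
      A.IsSymm ∧ (A.map Complex.im).PosDef ∧ R = matrixGraph A := by
  obtain ⟨A, rfl⟩ := exists_eq_matrixGraph hR.finrank_eq fun Y hY hY2 => by
    by_contra h0
    have hlt := hpos Y hY h0
    simp [symplForm_eq_dotProduct, hY2] at hlt
  have hA := isSymm_of_isLagrangian_matrixGraph hR
  exact ⟨A, hA, posDef_of_isPositive_matrixGraph hA hpos, rfl⟩

end Lagrangian

section Tilt

open scoped ComplexOrder Matrix

variable {n : ℕ}

/-- The map `X ↦ X - i J X`, twice the orthogonal projection of `ℂ²ⁿ` onto the positive Lagrangian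
subspace `{(P, Q) | P = i Q}`; it makes a null vector of the form `(1/i) ω(Y, Y*)` positive. -/
def tilt (n : ℕ) : Phase n ℂ →ₗ[ℂ] Phase n ℂ := LinearMap.id - Complex.I • phaseRot n

theorem tilt_apply (X : Phase n ℂ) : tilt n X = X - Complex.I • phaseRot n X := rfl

theorem star_tilt (X : Phase n ℂ) :
    star (tilt n X) = star X + Complex.I • phaseRot n (star X) := by
  simp [tilt_apply, star_phaseRot]

theorem symplBilin_tilt_right (W X : Phase n ℂ) :
    symplBilin n W (tilt n X) = symplBilin n W X - Complex.I * phaseDot n W X := by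
  simp [tilt_apply, symplBilin_phaseRot_right]

theorem symplBilin_tilt_tilt (X X' : Phase n ℂ) : symplBilin n (tilt n X) (tilt n X') = 0 := by
  rw [symplBilin_tilt_right, tilt_apply]
  simp only [map_sub, map_smul, LinearMap.sub_apply, LinearMap.smul_apply, smul_eq_mul,
    symplBilin_phaseRot_left, phaseDot_phaseRot_left]
  linear_combination symplBilin n X X' * Complex.I_sq

theorem symplBilin_add_tilt {W W' X X' : Phase n ℂ} (hWW' : symplBilin n W W' = 0)
    (hWX' : symplBilin n W X' = 0) (hW'X : symplBilin n W' X = 0)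
    (hdot : phaseDot n W X' = 0) (hdot' : phaseDot n W' X = 0) :
    symplBilin n (W + tilt n X) (W' + tilt n X') = 0 := by
  have hright : symplBilin n W (tilt n X') = 0 := by
    rw [symplBilin_tilt_right, hWX', hdot, mul_zero, sub_zero]
  have hleft : symplBilin n (tilt n X) W' = 0 := by
    rw [symplBilin_swap, symplBilin_tilt_right, hW'X, hdot', mul_zero, sub_zero, neg_zero]
  simp only [map_add, LinearMap.add_apply, hWW', hright, hleft, symplBilin_tilt_tilt, add_zero]

theorem symplBilin_tilt_star_tilt (X : Phase n ℂ) :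
    symplBilin n (tilt n X) (star (tilt n X))
      = 2 * (symplBilin n X (star X) + Complex.I * phaseDot n X (star X)) := by
  rw [star_tilt, tilt_apply]
  simp only [map_add, map_sub, map_smul, LinearMap.sub_apply, LinearMap.smul_apply, smul_eq_mul,
    symplBilin_phaseRot_right, symplBilin_phaseRot_left, phaseDot_phaseRot_left]
  linear_combination -symplBilin n X (star X) * Complex.I_sq

theorem symplBilin_add_tilt_star {W X : Phase n ℂ} (hW : symplBilin n W (star X) = 0)
    (hdot : phaseDot n W (star X) = 0) (hX : symplBilin n X (star X) = 0) :
    (1 / Complex.I) * symplBilin n (W + tilt n X) (star (W + tilt n X))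
      = (1 / Complex.I) * symplBilin n W (star W) + 2 * phaseDot n X (star X) := by
  have hright : symplBilin n W (star (tilt n X)) = 0 := by
    rw [star_tilt, map_add, map_smul, symplBilin_phaseRot_right, hW, hdot, smul_zero, add_zero]
  have hleft : symplBilin n (tilt n X) (star W) = 0 := by
    rw [symplBilin_swap, ← star_star (tilt n X), ← star_symplBilin, hright, star_zero, neg_zero]
  rw [star_add, map_add, map_add, LinearMap.add_apply, LinearMap.add_apply, hright, hleft,
    symplBilin_tilt_star_tilt, hX]
  field_simp
  ring

theorem isCompl_orthogonal_phaseDot {C : Submodule ℂ (Phase n ℂ)} (hC : ∀ Y ∈ C, star Y ∈ C) :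
    IsCompl C ((phaseDot n).orthogonal C) := by
  have hrefl : (phaseDot n).IsRefl := fun X Y h => by rw [phaseDot_comm, h]
  rw [LinearMap.BilinForm.isCompl_orthogonal_iff_disjoint hrefl, Submodule.disjoint_def]
  intro X hX hX'
  rw [← phaseDot_star_self_eq_zero, phaseDot_comm]
  exact (LinearMap.BilinForm.mem_orthogonal_iff.1 hX') _ (hC X hX)

/-- The map that tilts `C` and is the identity on its orthogonal complement for the dot product. -/
noncomputable def tiltAlong (C : Submodule ℂ (Phase n ℂ)) (hC : ∀ Y ∈ C, star Y ∈ C) :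
    Phase n ℂ →ₗ[ℂ] Phase n ℂ :=
  LinearMap.id - Complex.I • phaseRot n ∘ₗ C.projection _ (isCompl_orthogonal_phaseDot hC)

variable {C r : Submodule ℂ (Phase n ℂ)} {hC : ∀ Y ∈ C, star Y ∈ C}

theorem tiltAlong_orthogonal {W : Phase n ℂ} (hW : W ∈ (phaseDot n).orthogonal C) :
    tiltAlong C hC W = W := by
  rw [tiltAlong, LinearMap.sub_apply, LinearMap.smul_apply, LinearMap.comp_apply,
    (Submodule.projection_apply_eq_zero_iff _).2 hW, map_zero, smul_zero, sub_zero,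
    LinearMap.id_apply]

theorem tiltAlong_mem {X : Phase n ℂ} (hX : X ∈ C) : tiltAlong C hC X = tilt n X := by
  rw [tiltAlong, LinearMap.sub_apply, LinearMap.smul_apply, LinearMap.comp_apply,
    Submodule.projection_apply_of_mem_left _ hX, LinearMap.id_apply, tilt_apply]

theorem exists_add_eq_tiltAlong (hC : ∀ Y ∈ C, star Y ∈ C) (hCr : C ≤ r) {Y : Phase n ℂ}
    (hY : Y ∈ r) : ∃ X ∈ C, ∃ W ∈ r, W ∈ (phaseDot n).orthogonal C ∧ W + X = Y ∧
      tiltAlong C hC Y = W + tilt n X := by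
  obtain ⟨X, hX, W, hW, rfl⟩ := Submodule.mem_sup.1
    ((isCompl_orthogonal_phaseDot hC).sup_eq_top.symm ▸ Submodule.mem_top (x := Y))
  exact ⟨X, hX, W, (Submodule.add_mem_iff_right _ (hCr hX)).1 hY, hW, add_comm W X, by
    rw [map_add, tiltAlong_mem hX, tiltAlong_orthogonal hW, add_comm]⟩

theorem phaseDot_eq_zero_of_mem_orthogonal {W X : Phase n ℂ}
    (hW : W ∈ (phaseDot n).orthogonal C) (hX : X ∈ C) : phaseDot n W X = 0 := by
  rw [phaseDot_comm]
  exact LinearMap.BilinForm.mem_orthogonal_iff.1 hW X hX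

theorem symplForm_tiltAlong_eq_zero (hr : IsLagrangian r) (hCr : C ≤ r) {Y Y' : Phase n ℂ}
    (hY : Y ∈ r) (hY' : Y' ∈ r) : symplForm (tiltAlong C hC Y) (tiltAlong C hC Y') = 0 := by
  obtain ⟨X, hX, W, hWr, hW, -, hT⟩ := exists_add_eq_tiltAlong hC hCr hY
  obtain ⟨X', hX', W', hWr', hW', -, hT'⟩ := exists_add_eq_tiltAlong hC hCr hY'
  rw [hT, hT']
  exact symplBilin_add_tilt (hr.symplForm_eq_zero hWr hWr')
    (hr.symplForm_eq_zero hWr (hCr hX')) (hr.symplForm_eq_zero hWr' (hCr hX))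
    (phaseDot_eq_zero_of_mem_orthogonal hW hX') (phaseDot_eq_zero_of_mem_orthogonal hW' hX)

theorem symplForm_tiltAlong_star_pos (hr : IsLagrangian r) (hCr : C ≤ r)
    (hpos : ∀ Y ∈ r, Y ∉ C → 0 < (1 / Complex.I) * symplForm Y (star Y))
    {Y : Phase n ℂ} (hY : Y ∈ r) (hY0 : Y ≠ 0) :
    0 < (1 / Complex.I) * symplForm (tiltAlong C hC Y) (star (tiltAlong C hC Y)) := by
  obtain ⟨X, hX, W, hWr, hW, rfl, hT⟩ := exists_add_eq_tiltAlong hC hCr hY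
  have hvalue := symplBilin_add_tilt_star (hr.symplForm_eq_zero hWr (hCr (hC X hX)))
    (phaseDot_eq_zero_of_mem_orthogonal hW (hC X hX))
    (hr.symplForm_eq_zero (hCr hX) (hCr (hC X hX)))
  rw [hT, ← symplBilin_apply, hvalue]
  by_cases hWC : W ∈ C
  · obtain rfl : W = 0 := phaseDot_star_self_eq_zero.1
      (phaseDot_eq_zero_of_mem_orthogonal hW (hC W hWC))
    rw [map_zero, LinearMap.zero_apply, mul_zero, zero_add]
    exact mul_pos two_pos (phaseDot_star_self_pos fun h => hY0 (by rw [h, zero_add]))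
  · exact add_pos_of_pos_of_nonneg (hpos W hWr hWC)
      (mul_nonneg two_pos.le (phaseDot_star_self_nonneg X))

theorem exists_isLagrangian_isPositive (hr : IsLagrangian r) (hCr : C ≤ r)
    (hC : ∀ Y ∈ C, star Y ∈ C)
    (hpos : ∀ Y ∈ r, Y ∉ C → 0 < (1 / Complex.I) * symplForm Y (star Y)) :
    ∃ R : Submodule ℂ (Phase n ℂ), IsLagrangian R ∧ IsPositive R ∧ r ≤ C ⊔ R := by
  have hinj : Function.Injective ((tiltAlong C hC).domRestrict r) := by
    refine (injective_iff_map_eq_zero _).2 fun Y hY => Subtype.ext ?_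
    by_contra hY0
    have hlt := symplForm_tiltAlong_star_pos (hC := hC) hr hCr hpos Y.2 hY0
    rw [show tiltAlong C hC Y = 0 from hY, ← symplBilin_apply, map_zero, LinearMap.zero_apply,
      mul_zero] at hlt
    exact lt_irrefl _ hlt
  refine ⟨r.map (tiltAlong C hC), isLagrangian_of_finrank_eq ?_ ?_, ?_, fun Y hY => ?_⟩
  · rw [← LinearMap.range_domRestrict, LinearMap.finrank_range_of_inj hinj, hr.finrank_eq]
  · rintro _ ⟨Y, hY, rfl⟩ _ ⟨Y', hY', rfl⟩
    exact symplForm_tiltAlong_eq_zero hr hCr hY hY'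
  · rintro _ ⟨Y, hY, rfl⟩ hne
    exact symplForm_tiltAlong_star_pos hr hCr hpos hY fun h => hne (by rw [h, map_zero])
  · obtain ⟨X, hX, W, hWr, hW, rfl, -⟩ := exists_add_eq_tiltAlong hC hCr hY
    exact add_comm X W ▸ Submodule.add_mem_sup hX ⟨W, hWr, tiltAlong_orthogonal hW⟩

end Tilt

section Complexification

open scoped ComplexOrder

variable {n : ℕ}

theorem toComplex_mem_complexify {L : Submodule ℝ (Phase n ℝ)} {X : Phase n ℝ} (hX : X ∈ L) :
    X.toComplex ∈ complexify L :=
  Submodule.subset_span (Set.mem_image_of_mem _ hX)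

theorem star_toComplex (X : Phase n ℝ) : star X.toComplex = X.toComplex := by
  ext <;> simp [Phase.toComplex]

theorem toComplex_smul (t : ℝ) (X : Phase n ℝ) :
    (t • X).toComplex = (t : ℂ) • X.toComplex := by
  ext <;> simp [Phase.toComplex]

theorem exists_add_star_eq_toComplex {R : Submodule ℂ (Phase n ℂ)} (hR : R ⊔ conjSubspace R = ⊤)
    (X : Phase n ℝ) : ∃ b ∈ R, X.toComplex = b + star b := by
  obtain ⟨a, ha, c, hc, hac⟩ := Submodule.mem_sup.1 (hR.symm ▸ Submodule.mem_top (x := X.toComplex))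
  refine ⟨(1 / 2 : ℂ) • (a + star c), R.smul_mem _ (R.add_mem ha hc), ?_⟩
  have hac' : star a + star c = X.toComplex := by rw [← star_add, hac, star_toComplex]
  calc X.toComplex = (1 / 2 : ℂ) • ((a + c) + (star a + star c)) := by rw [hac, hac']; module
    _ = (1 / 2 : ℂ) • (a + star c) + star ((1 / 2 : ℂ) • (a + star c)) := by
        rw [star_smul, star_add, star_star, show star (1 / 2 : ℂ) = 1 / 2 by simp]
        module

theorem star_mem_complexify {L : Submodule ℝ (Phase n ℝ)} {Y : Phase n ℂ}
    (hY : Y ∈ complexify L) : star Y ∈ complexify L := by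
  suffices hle : complexify L ≤ conjSubspace (complexify L) from hle hY
  refine Submodule.span_le.2 ?_
  rintro _ ⟨X, hX, rfl⟩
  change star X.toComplex ∈ complexify L
  rw [star_toComplex]
  exact toComplex_mem_complexify hX

theorem conjSubspace_complexify (L : Submodule ℝ (Phase n ℝ)) :
    conjSubspace (complexify L) = complexify L :=
  le_antisymm (fun Y hY => star_star Y ▸ star_mem_complexify hY) fun _ hY => star_mem_complexify hY

theorem star_mem_skewOrth_complexify {L : Submodule ℝ (Phase n ℝ)} {Y : Phase n ℂ}
    (hY : Y ∈ skewOrth (complexify L)) : star Y ∈ skewOrth (complexify L) := by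
  rwa [← conjSubspace_complexify, skewOrth_conjSubspace] at hY

theorem IsLagrangian.inf_conjSubspace_eq_complexify {L : Submodule ℝ (Phase n ℝ)}
    {r : Submodule ℂ (Phase n ℂ)} (hr : IsLagrangian r) (hCr : complexify L ≤ r)
    (hpos : ∀ Y ∈ r, Y ∉ complexify L → 0 < (1 / Complex.I) * symplForm Y (star Y)) :
    r ⊓ conjSubspace r = complexify L :=
  le_antisymm (hr.inf_conjSubspace_le hpos) fun _ hY => ⟨hCr hY, hCr (star_mem_complexify hY)⟩

end Complexification

section Operators

open scoped SchwartzMap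

variable {n : ℕ}

/-- The position operator, multiplication by `ξ j`, on the Schwartz space. -/
noncomputable def positionOp (j : Fin n) : 𝓢(Fin n → ℝ, ℂ) →ₗ[ℂ] 𝓢(Fin n → ℝ, ℂ) :=
  SchwartzMap.smulLeftCLM ℂ (fun ξ : Fin n → ℝ => (ξ j : ℂ))

/-- The momentum operator `(1/i) ∂/∂ξ j` on the Schwartz space. -/
noncomputable def momentumOp (j : Fin n) : 𝓢(Fin n → ℝ, ℂ) →ₗ[ℂ] 𝓢(Fin n → ℝ, ℂ) :=
  (1 / Complex.I) •
    (LineDeriv.lineDerivOpCLM ℂ 𝓢(Fin n → ℝ, ℂ) (Pi.single j 1 : Fin n → ℝ)).toLinearMap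

/-- The operator `Ω(Y)` of `OmegaOp` on the Schwartz space, as a linear function of `Y`. -/
noncomputable def fieldOp : Phase n ℂ →ₗ[ℂ] 𝓢(Fin n → ℝ, ℂ) →ₗ[ℂ] 𝓢(Fin n → ℝ, ℂ) :=
  ∑ j, ((LinearMap.proj j ∘ₗ LinearMap.fst ℂ _ _).smulRight (positionOp j)
    - (LinearMap.proj j ∘ₗ LinearMap.snd ℂ _ _).smulRight (momentumOp j))

theorem hasTemperateGrowth_ofReal_eval (j : Fin n) :
    (fun ξ : Fin n → ℝ => (ξ j : ℂ)).HasTemperateGrowth :=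
  (Complex.ofRealCLM ∘L
    ContinuousLinearMap.proj (R := ℝ) (φ := fun _ : Fin n => ℝ) j).hasTemperateGrowth

theorem positionOp_apply (j : Fin n) (f : 𝓢(Fin n → ℝ, ℂ)) (ξ : Fin n → ℝ) :
    positionOp j f ξ = ξ j * f ξ :=
  SchwartzMap.smulLeftCLM_apply_apply (hasTemperateGrowth_ofReal_eval j) f ξ

theorem momentumOp_apply (j : Fin n) (f : 𝓢(Fin n → ℝ, ℂ)) (ξ : Fin n → ℝ) :
    momentumOp j f ξ = (1 / Complex.I) * fderiv ℝ f ξ (Pi.single j 1) := by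
  simp [momentumOp, SchwartzMap.lineDerivOp_apply_eq_fderiv]

theorem fieldOp_apply (Y : Phase n ℂ) (f : 𝓢(Fin n → ℝ, ℂ)) :
    fieldOp Y f = ∑ j, (Y.1 j • positionOp j f - Y.2 j • momentumOp j f) := by
  simp [fieldOp, LinearMap.sum_apply]

theorem coe_fieldOp_apply (Y : Phase n ℂ) (f : 𝓢(Fin n → ℝ, ℂ)) :
    ⇑(fieldOp Y f) = OmegaOp Y f := by
  ext ξ
  simp only [fieldOp_apply, OmegaOp, sum_apply, sub_apply, smul_apply, positionOp_apply,
    momentumOp_apply, smul_eq_mul, mul_assoc]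

theorem positionOp_comm (j k : Fin n) (f : 𝓢(Fin n → ℝ, ℂ)) :
    positionOp j (positionOp k f) = positionOp k (positionOp j f) := by
  ext ξ
  simp only [positionOp_apply]
  ring

theorem fderiv_momentumOp (j : Fin n) (f : 𝓢(Fin n → ℝ, ℂ)) (ξ v : Fin n → ℝ) :
    fderiv ℝ (momentumOp j f) ξ v
      = (1 / Complex.I) * fderiv ℝ (fderiv ℝ f) ξ v (Pi.single j 1) := by
  have hf : DifferentiableAt ℝ (fderiv ℝ f) ξ :=
    ((f.smooth 2).fderiv_right (m := 1) (by norm_num)).differentiable (by simp) ξ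
  rw [show ⇑(momentumOp j f) = fun x => (1 / Complex.I) * fderiv ℝ f x (Pi.single j 1) from
    funext (momentumOp_apply j f), fderiv_const_mul (hf.clm_apply (by fun_prop)),
    fderiv_clm_apply hf (by fun_prop)]
  simp

theorem momentumOp_comm (j k : Fin n) (f : 𝓢(Fin n → ℝ, ℂ)) :
    momentumOp j (momentumOp k f) = momentumOp k (momentumOp j f) := by
  ext ξ
  have hsymm : IsSymmSndFDerivAt ℝ f ξ :=
    (f.smooth 2).contDiffAt.isSymmSndFDerivAt (by simp)
  simp only [momentumOp_apply, fderiv_momentumOp, hsymm.eq (Pi.single j 1) (Pi.single k 1)]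

theorem momentumOp_positionOp (j k : Fin n) (f : 𝓢(Fin n → ℝ, ℂ)) :
    momentumOp j (positionOp k f)
      = positionOp k (momentumOp j f) + (if j = k then 1 / Complex.I else 0) • f := by
  ext ξ
  have hpos : HasFDerivAt (fun x : Fin n → ℝ => (x k : ℂ))
      (Complex.ofRealCLM ∘L ContinuousLinearMap.proj k) ξ :=
    (Complex.ofRealCLM ∘L
      ContinuousLinearMap.proj (R := ℝ) (φ := fun _ : Fin n => ℝ) k).hasFDerivAt
  have hprod : fderiv ℝ (positionOp k f) ξ (Pi.single j 1)
      = ξ k * fderiv ℝ f ξ (Pi.single j 1) + (if j = k then 1 else 0) * f ξ := by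
    rw [show ⇑(positionOp k f) = (fun x => (x k : ℂ)) * ⇑f from funext (positionOp_apply k f),
      (hpos.mul (f.hasFDerivAt ξ)).fderiv]
    rcases eq_or_ne j k with rfl | hjk
    · simp
    · simp [hjk]
  rw [momentumOp_apply, hprod, add_apply, smul_apply, positionOp_apply, momentumOp_apply,
    smul_eq_mul]
  split_ifs <;> ring

theorem fieldOp_comm (Y Z : Phase n ℂ) (f : 𝓢(Fin n → ℝ, ℂ)) :
    fieldOp Y (fieldOp Z f) = fieldOp Z (fieldOp Y f) + ((1 / Complex.I) * symplForm Y Z) • f := by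
  have hexp : ∀ Y Z : Phase n ℂ, fieldOp Y (fieldOp Z f) = ∑ j, ∑ k,
      (Y.1 j • (Z.1 k • positionOp j (positionOp k f) - Z.2 k • positionOp j (momentumOp k f))
        - Y.2 j • (Z.1 k • momentumOp j (positionOp k f)
          - Z.2 k • momentumOp j (momentumOp k f))) := fun Y Z => by
    rw [fieldOp_apply Y]
    refine Finset.sum_congr rfl fun j _ => ?_
    simp only [fieldOp_apply Z, map_sum, map_sub, map_smul, Finset.smul_sum,
      ← Finset.sum_sub_distrib]
  have hform : ((1 / Complex.I) * symplForm Y Z) • f = ∑ j, ∑ k,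
      ((if j = k then 1 / Complex.I else 0) * (Y.1 j * Z.2 k - Z.1 k * Y.2 j)) • f := by
    simp only [ite_mul, zero_mul, ite_smul, zero_smul, Finset.sum_ite_eq, Finset.mem_univ, if_true,
      symplForm, Finset.mul_sum, Finset.sum_smul]
  rw [hexp Y Z, hexp Z Y, Finset.sum_comm (γ := Fin n), hform, ← Finset.sum_add_distrib]
  refine Finset.sum_congr rfl fun j _ => ?_
  rw [← Finset.sum_add_distrib]
  refine Finset.sum_congr rfl fun k _ => ?_
  rw [positionOp_comm k j, momentumOp_comm k j, momentumOp_positionOp k j,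
    momentumOp_positionOp j k]
  rcases eq_or_ne j k with rfl | hjk
  · simp only [if_true]
    module
  · simp only [hjk, hjk.symm, if_false]
    module

end Operators

section TemperateExponentials

open scoped SchwartzMap

variable {V : Type*} [NormedAddCommGroup V] [NormedSpace ℝ V]

theorem norm_iteratedFDeriv_real_cexp (i : ℕ) (z : ℂ) :
    ‖iteratedFDeriv ℝ i Complex.exp z‖ = ‖Complex.exp z‖ := by
  have hrestrict : iteratedFDeriv ℝ i Complex.exp z
      = (iteratedFDeriv ℂ i Complex.exp z).restrictScalars ℝ := by
    simpa using ((Complex.contDiff_exp (𝕜 := ℂ) (n := i)).contDiffAt (x := z)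
      |>.restrictScalars_iteratedFDeriv (𝕜 := ℝ)).symm
  rw [hrestrict, ContinuousMultilinearMap.norm_restrictScalars,
    norm_iteratedFDeriv_eq_norm_iteratedDeriv, iteratedDeriv_eq_iterate, Complex.iter_deriv_exp]

theorem exists_norm_iteratedFDeriv_cexp_le {Φ : V → ℂ} (hΦ : Φ.HasTemperateGrowth) (i : ℕ) :
    ∃ (k : ℕ) (C : ℝ), ∀ x, ‖iteratedFDeriv ℝ i (fun x => Complex.exp (Φ x)) x‖
      ≤ C * (1 + ‖x‖) ^ k * Real.exp (Φ x).re := by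
  obtain ⟨k, D, hD, hk⟩ := hΦ.norm_iteratedFDeriv_le_uniform i
  refine ⟨k * i, i.factorial * (1 + D) ^ i, fun x => ?_⟩
  have hDx : (1 : ℝ) ≤ (1 + D) * (1 + ‖x‖) ^ k :=
    one_le_mul_of_one_le_of_one_le (by linarith) (one_le_pow₀ (by simp))
  have hΦx : ∀ j, 1 ≤ j → j ≤ i → ‖iteratedFDeriv ℝ j Φ x‖ ≤ ((1 + D) * (1 + ‖x‖) ^ k) ^ j :=
    fun j hj hji => calc
      ‖iteratedFDeriv ℝ j Φ x‖ ≤ D * (1 + ‖x‖) ^ k := hk j hji x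
      _ ≤ (1 + D) * (1 + ‖x‖) ^ k := by gcongr; simp
      _ ≤ _ := le_self_pow₀ hDx (by omega)
  calc _ ≤ i.factorial * Real.exp (Φ x).re * ((1 + D) * (1 + ‖x‖) ^ k) ^ i :=
        norm_iteratedFDeriv_comp_le (N := ((⊤ : ℕ∞) : WithTop ℕ∞)) Complex.contDiff_exp hΦ.1
          (mod_cast le_top) x
          (fun j _ => by rw [norm_iteratedFDeriv_real_cexp, Complex.norm_exp]) hΦx
    _ = _ := by rw [mul_pow, pow_mul]; ring

theorem hasTemperateGrowth_cexp {Φ : V → ℂ} (hΦ : Φ.HasTemperateGrowth) {C : ℝ}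
    (hre : ∀ x, (Φ x).re ≤ C) : (fun x => Complex.exp (Φ x)).HasTemperateGrowth := by
  refine ⟨Complex.contDiff_exp.comp hΦ.1, fun i => ?_⟩
  obtain ⟨k, D, hD⟩ := exists_norm_iteratedFDeriv_cexp_le hΦ i
  refine ⟨k, |D| * Real.exp C, fun x => (hD x).trans ?_⟩
  calc D * (1 + ‖x‖) ^ k * Real.exp (Φ x).re ≤ |D| * (1 + ‖x‖) ^ k * Real.exp C := by
        gcongr
        · exact le_abs_self D
        · exact hre x
    _ = |D| * Real.exp C * (1 + ‖x‖) ^ k := by ring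

theorem exists_schwartz_cexp {Φ : V → ℂ} (hΦ : Φ.HasTemperateGrowth) {C : ℝ}
    (hre : ∀ x, (Φ x).re ≤ C - ‖x‖) : ∃ g : 𝓢(V, ℂ), ∀ x, g x = Complex.exp (Φ x) := by
  refine ⟨⟨fun x => Complex.exp (Φ x), Complex.contDiff_exp.comp hΦ.1, fun m i => ?_⟩,
    fun x => rfl⟩
  obtain ⟨k, D, hD⟩ := exists_norm_iteratedFDeriv_cexp_le hΦ i
  refine ⟨|D| * ((m + k).factorial * Real.exp (C + 1)), fun x => ?_⟩
  have hpow : (1 + ‖x‖) ^ (m + k) ≤ (m + k).factorial * Real.exp (1 + ‖x‖) := by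
    have := Real.pow_div_factorial_le_exp (1 + ‖x‖) (by positivity) (m + k)
    rwa [div_le_iff₀ (by positivity), mul_comm (Real.exp _)] at this
  calc ‖x‖ ^ m * ‖iteratedFDeriv ℝ i (fun x => Complex.exp (Φ x)) x‖
      ≤ (1 + ‖x‖) ^ m * (|D| * (1 + ‖x‖) ^ k * Real.exp (C - ‖x‖)) := by
        gcongr
        · simp
        · refine (hD x).trans ?_
          gcongr
          · exact le_abs_self D
          · exact hre x
    _ = |D| * ((1 + ‖x‖) ^ (m + k) * Real.exp (C - ‖x‖)) := by ring
    _ ≤ |D| * ((m + k).factorial * Real.exp (1 + ‖x‖) * Real.exp (C - ‖x‖)) := by gcongr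
    _ = |D| * ((m + k).factorial * Real.exp (C + 1)) := by
        rw [mul_assoc (_ : ℝ) (Real.exp _), ← Real.exp_add]
        ring_nf

end TemperateExponentials

section InnerProduct

open scoped SchwartzMap
open MeasureTheory

variable {n : ℕ}

theorem integrable_star_mul (f g : 𝓢(Fin n → ℝ, ℂ)) :
    Integrable (fun ξ => star (f ξ) * g ξ) :=
  (g.integrable (μ := volume)).bdd_mul (by fun_prop) (Filter.Eventually.of_forall fun ξ => by
    rw [norm_star]
    exact SchwartzMap.norm_le_seminorm ℂ f ξ)

/-- The inner product `(f, g) = ∫ conj (f ξ) * g ξ dξ` of `L²(ℝⁿ)`, as a sesquilinear form on the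
Schwartz space. -/
noncomputable def l2Form : 𝓢(Fin n → ℝ, ℂ) →ₗ⋆[ℂ] 𝓢(Fin n → ℝ, ℂ) →ₗ[ℂ] ℂ :=
  LinearMap.mk₂'ₛₗ _ _ (fun f g => ∫ ξ, star (f ξ) * g ξ)
    (fun f f' g => by
      simp only [add_apply, star_add, add_mul]
      exact integral_add (integrable_star_mul f g) (integrable_star_mul f' g))
    (fun c f g => by simp [mul_assoc, integral_const_mul])
    (fun f g g' => by
      simp only [add_apply, mul_add]
      exact integral_add (integrable_star_mul f g) (integrable_star_mul f g'))
    (fun c f g => by simp [mul_left_comm, integral_const_mul])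

theorem l2Form_apply (f g : 𝓢(Fin n → ℝ, ℂ)) : l2Form f g = ∫ ξ, star (f ξ) * g ξ := rfl

theorem l2Form_positionOp (j : Fin n) (f g : 𝓢(Fin n → ℝ, ℂ)) :
    l2Form (positionOp j f) g = l2Form f (positionOp j g) := by
  simp only [l2Form_apply, positionOp_apply, star_mul', Complex.star_def, Complex.conj_ofReal,
    mul_assoc, mul_left_comm]

theorem l2Form_momentumOp (j : Fin n) (f g : 𝓢(Fin n → ℝ, ℂ)) :
    l2Form (momentumOp j f) g = l2Form f (momentumOp j g) := by
  have hparts : ∫ ξ, star (f ξ) * fderiv ℝ g ξ (Pi.single j 1)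
      = -∫ ξ, star (fderiv ℝ f ξ (Pi.single j 1)) * g ξ := by
    simpa [SchwartzMap.lineDerivOp_apply_eq_fderiv] using
      SchwartzMap.integral_bilinear_lineDerivOp_right_eq_neg_left (μ := volume) f g
        (ContinuousLinearMap.mul ℝ ℂ ∘L Complex.conjCLE.toContinuousLinearMap) (Pi.single j 1)
  simp only [l2Form_apply, momentumOp_apply, mul_left_comm _ (1 / Complex.I), integral_const_mul,
    hparts, star_mul', mul_assoc]
  simp

theorem l2Form_fieldOp (Y : Phase n ℂ) (f g : 𝓢(Fin n → ℝ, ℂ)) :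
    l2Form (fieldOp Y f) g = l2Form f (fieldOp (star Y) g) := by
  simp only [fieldOp_apply, map_sum, map_sub, LinearMap.sum_apply, LinearMap.sub_apply, map_smulₛₗ,
    LinearMap.smul_apply, l2Form_positionOp, l2Form_momentumOp, RingHom.id_apply]
  rfl

end InnerProduct

section WeylOperators

open scoped SchwartzMap

variable {n : ℕ}

theorem hasTemperateGrowth_weyl_phase (X : Phase n ℝ) :
    (fun ξ : Fin n → ℝ => Complex.exp (Complex.I *
      ((∑ j, X.1 j * ξ j - (1 / 2) * ∑ j, X.1 j * X.2 j : ℝ) : ℂ))).HasTemperateGrowth := by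
  refine hasTemperateGrowth_cexp (C := 0) ?_ fun ξ => by simp
  have hdot : (fun ξ : Fin n → ℝ => ∑ j, X.1 j * ξ j).HasTemperateGrowth :=
    .sum fun j _ =>
      (X.1 j • ContinuousLinearMap.proj (R := ℝ) (φ := fun _ => ℝ) j).hasTemperateGrowth
  exact (Function.HasTemperateGrowth.const Complex.I).mul
    (Function.Complex.hasTemperateGrowth_ofReal.comp (hdot.sub (.const _)))

/-- The Weyl operator `e^{iΩ(X)}` of `weyl` on the Schwartz space. -/
noncomputable def weylOp (X : Phase n ℝ) : 𝓢(Fin n → ℝ, ℂ) →ₗ[ℂ] 𝓢(Fin n → ℝ, ℂ) :=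
  (SchwartzMap.smulLeftCLM ℂ (fun ξ : Fin n → ℝ => Complex.exp (Complex.I *
    ((∑ j, X.1 j * ξ j - (1 / 2) * ∑ j, X.1 j * X.2 j : ℝ) : ℂ)))
    ∘L SchwartzMap.compSubConstCLM ℂ X.2).toLinearMap

theorem coe_weylOp_apply (X : Phase n ℝ) (f : 𝓢(Fin n → ℝ, ℂ)) : ⇑(weylOp X f) = weyl X f := by
  ext ξ
  exact SchwartzMap.smulLeftCLM_apply_apply (hasTemperateGrowth_weyl_phase X) _ ξ

theorem norm_weyl (X : Phase n ℝ) (f : (Fin n → ℝ) → ℂ) (ξ : Fin n → ℝ) :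
    ‖weyl X f ξ‖ = ‖f (ξ - X.2)‖ := by
  rw [weyl, norm_mul, mul_comm Complex.I, Complex.norm_exp_ofReal_mul_I, one_mul]

theorem positionOp_weylOp (j : Fin n) (X : Phase n ℝ) (f : 𝓢(Fin n → ℝ, ℂ)) :
    positionOp j (weylOp X f) = weylOp X (positionOp j f) + (X.2 j : ℂ) • weylOp X f := by
  ext ξ
  simp only [positionOp_apply, coe_weylOp_apply, weyl, add_apply, smul_apply, smul_eq_mul,
    Pi.sub_apply]
  push_cast
  ring

theorem fderiv_weyl (X : Phase n ℝ) (f : 𝓢(Fin n → ℝ, ℂ)) (ξ v : Fin n → ℝ) :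
    fderiv ℝ (weyl X f) ξ v
      = Complex.I * ((∑ j, X.1 j * v j : ℝ) : ℂ) * weyl X f ξ
        + weyl X (fun x => fderiv ℝ f x v) ξ := by
  have hphase : HasFDerivAt (fun ξ : Fin n → ℝ =>
      ((∑ j, X.1 j * ξ j - (1 / 2) * ∑ j, X.1 j * X.2 j : ℝ) : ℂ))
      (Complex.ofRealCLM ∘L ∑ j, X.1 j • ContinuousLinearMap.proj j) ξ :=
    Complex.ofRealCLM.hasFDerivAt.comp ξ ((HasFDerivAt.fun_sum fun j _ =>
      (hasFDerivAt_apply j ξ).const_mul (X.1 j)).sub_const _)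
  have hshift : HasFDerivAt (fun ξ => f (ξ - X.2)) (fderiv ℝ f (ξ - X.2)) ξ :=
    (hasFDerivAt_comp_sub X.2).2 (f.hasFDerivAt _)
  have hweyl : HasFDerivAt (weyl X f) _ ξ := (hphase.const_mul Complex.I).cexp.mul hshift
  rw [hweyl.fderiv]
  simp only [weyl, add_apply, smul_apply, ContinuousLinearMap.comp_apply, sum_apply,
    ContinuousLinearMap.proj_apply, Complex.ofRealCLM_apply, smul_eq_mul]
  ring

theorem momentumOp_weylOp (j : Fin n) (X : Phase n ℝ) (f : 𝓢(Fin n → ℝ, ℂ)) :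
    momentumOp j (weylOp X f) = weylOp X (momentumOp j f) + (X.1 j : ℂ) • weylOp X f := by
  ext ξ
  simp only [momentumOp_apply, coe_weylOp_apply, fderiv_weyl, add_apply, smul_apply, smul_eq_mul,
    Pi.single_apply, mul_ite, mul_one, mul_zero, Finset.sum_ite_eq', Finset.mem_univ, if_true,
    weyl, mul_add]
  field_simp
  ring

theorem fieldOp_weylOp (Y : Phase n ℂ) (X : Phase n ℝ) (f : 𝓢(Fin n → ℝ, ℂ)) :
    fieldOp Y (weylOp X f) = weylOp X (fieldOp Y f) + symplForm Y X.toComplex • weylOp X f := by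
  simp only [fieldOp_apply, positionOp_weylOp, momentumOp_weylOp, map_sum, map_sub, map_smul,
    symplForm, Finset.sum_smul, ← Finset.sum_add_distrib, Phase.toComplex]
  exact Finset.sum_congr rfl fun j _ => by module

end WeylOperators

section WeylCoefficients

open scoped SchwartzMap
open MeasureTheory

variable {n : ℕ}

/-- The coefficient `X ↦ (f, e^{iΩ(X)} g)` of the Weyl representation, whose integral over the
constraint plane is `constraintInner`. -/
noncomputable def weylCoeff (f g : 𝓢(Fin n → ℝ, ℂ)) (X : Phase n ℝ) : ℂ :=
  l2Form f (weylOp X g)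

theorem weylCoeff_apply (f g : 𝓢(Fin n → ℝ, ℂ)) (X : Phase n ℝ) :
    weylCoeff f g X = ∫ ξ, star (f ξ) * weyl X g ξ := by
  simp only [weylCoeff, l2Form_apply, coe_weylOp_apply]

theorem weylCoeff_fieldOp_left (Y : Phase n ℂ) (f g : 𝓢(Fin n → ℝ, ℂ)) (X : Phase n ℝ) :
    weylCoeff (fieldOp Y f) g X = weylCoeff f (fieldOp (star Y) g) X
      + symplForm (star Y) X.toComplex * weylCoeff f g X := by
  simp only [weylCoeff, l2Form_fieldOp, fieldOp_weylOp, map_add, map_smul, smul_eq_mul]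

-- Moving a coordinate operator across the Weyl operator trades a factor `X` for operators acting on
-- `f` and `g`, so boundedness of all the coefficients gives their rapid decay.
theorem fst_mul_weylCoeff (j : Fin n) (f g : 𝓢(Fin n → ℝ, ℂ)) (X : Phase n ℝ) :
    X.1 j * weylCoeff f g X
      = weylCoeff (momentumOp j f) g X - weylCoeff f (momentumOp j g) X := by
  simp only [weylCoeff, l2Form_momentumOp, momentumOp_weylOp, map_add, map_smul, smul_eq_mul,
    add_sub_cancel_left]

theorem snd_mul_weylCoeff (j : Fin n) (f g : 𝓢(Fin n → ℝ, ℂ)) (X : Phase n ℝ) :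
    X.2 j * weylCoeff f g X
      = weylCoeff (positionOp j f) g X - weylCoeff f (positionOp j g) X := by
  simp only [weylCoeff, l2Form_positionOp, positionOp_weylOp, map_add, map_smul, smul_eq_mul,
    add_sub_cancel_left]

theorem exists_norm_weyl_le (g : 𝓢(Fin n → ℝ, ℂ)) : ∃ C, ∀ X ξ, ‖weyl X g ξ‖ ≤ C :=
  ⟨_, fun X ξ => (norm_weyl X g ξ).trans_le (SchwartzMap.norm_le_seminorm ℂ g _)⟩

theorem exists_norm_weylCoeff_le (f g : 𝓢(Fin n → ℝ, ℂ)) : ∃ C, ∀ X, ‖weylCoeff f g X‖ ≤ C := by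
  obtain ⟨C, hC⟩ := exists_norm_weyl_le g
  refine ⟨∫ ξ, ‖f ξ‖ * C, fun X => ?_⟩
  rw [weylCoeff_apply]
  refine norm_integral_le_of_norm_le (f.integrable.norm.mul_const C)
    (Filter.Eventually.of_forall fun ξ => ?_)
  rw [norm_mul, norm_star]
  exact mul_le_mul_of_nonneg_left (hC X ξ) (norm_nonneg _)

theorem continuous_weylCoeff (f g : 𝓢(Fin n → ℝ, ℂ)) : Continuous (weylCoeff f g) := by
  obtain ⟨C, hC⟩ := exists_norm_weyl_le g
  simp only [funext (weylCoeff_apply f g)]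
  refine continuous_of_dominated (bound := fun ξ => ‖f ξ‖ * C) (fun X => ?_)
    (fun X => Filter.Eventually.of_forall fun ξ => ?_) (f.integrable.norm.mul_const C)
    (Filter.Eventually.of_forall fun ξ => ?_)
  · rw [← coe_weylOp_apply]
    exact (integrable_star_mul f _).aestronglyMeasurable
  · rw [norm_mul, norm_star]
    exact mul_le_mul_of_nonneg_left (hC X ξ) (norm_nonneg _)
  · unfold weyl
    fun_prop

theorem fieldOp_toComplex_apply (V : Phase n ℝ) (g : 𝓢(Fin n → ℝ, ℂ)) (ξ : Fin n → ℝ) :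
    fieldOp V.toComplex g ξ
      = ((∑ j, V.1 j * ξ j : ℝ) : ℂ) * g ξ + Complex.I * fderiv ℝ g ξ V.2 := by
  have hgrad : fderiv ℝ g ξ V.2 = ∑ j, (V.2 j : ℂ) * fderiv ℝ g ξ (Pi.single j 1) := by
    conv_lhs => rw [pi_eq_sum_univ' V.2]
    simp only [map_sum, map_smul, Complex.real_smul]
  rw [coe_fieldOp_apply, OmegaOp, hgrad]
  simp only [Phase.toComplex, Finset.sum_sub_distrib, Finset.mul_sum, Finset.sum_mul,
    Complex.ofReal_sum, Complex.ofReal_mul]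
  simp [mul_left_comm, sub_eq_add_neg]

theorem hasDerivAt_weyl (g : 𝓢(Fin n → ℝ, ℂ)) (X V : Phase n ℝ) (ξ : Fin n → ℝ) (t : ℝ) :
    HasDerivAt (fun t : ℝ => weyl (X + t • V) g ξ)
      (Complex.I * weyl (X + t • V) (fieldOp V.toComplex g) ξ
        + Complex.I / 2 * symplForm V X * weyl (X + t • V) g ξ) t := by
  have hfst : ∀ j, HasDerivAt (fun t : ℝ => (X + t • V).1 j) (V.1 j) t := fun j => by
    simpa using ((hasDerivAt_id t).mul_const (V.1 j)).const_add (X.1 j)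
  have hsnd : ∀ j, HasDerivAt (fun t : ℝ => (X + t • V).2 j) (V.2 j) t := fun j => by
    simpa using ((hasDerivAt_id t).mul_const (V.2 j)).const_add (X.2 j)
  have hphase : HasDerivAt (fun t : ℝ => ((∑ j, (X + t • V).1 j * ξ j
      - (1 / 2) * ∑ j, (X + t • V).1 j * (X + t • V).2 j : ℝ) : ℂ)) _ t :=
    ((HasDerivAt.fun_sum fun j _ => (hfst j).mul_const (ξ j)).sub ((HasDerivAt.fun_sum fun j _ =>
      (hfst j).mul (hsnd j)).const_mul (1 / 2))).ofReal_comp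
  have hshift : HasDerivAt (fun t : ℝ => g (ξ - (X + t • V).2))
      (fderiv ℝ g (ξ - (X + t • V).2) (-V.2)) t :=
    (g.hasFDerivAt _).comp_hasDerivAt t ((hasDerivAt_pi.2 hsnd).const_sub ξ)
  have hweyl : HasDerivAt (fun t : ℝ => weyl (X + t • V) g ξ) _ t :=
    (hphase.const_mul Complex.I).cexp.mul hshift
  convert hweyl using 1
  have hform : symplForm V X = ∑ j, V.1 j * (X + t • V).2 j - ∑ j, (X + t • V).1 j * V.2 j := by
    rw [symplForm, ← Finset.sum_sub_distrib]
    refine Finset.sum_congr rfl fun j _ => ?_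
    simp only [Prod.fst_add, Prod.snd_add, Prod.smul_fst, Prod.smul_snd, Pi.add_apply,
      Pi.smul_apply, smul_eq_mul]
    ring
  rw [weyl, weyl, fieldOp_toComplex_apply, hform]
  simp only [map_neg, Pi.sub_apply, mul_sub, Finset.sum_sub_distrib, Finset.sum_add_distrib]
  generalize Complex.exp _ = e
  push_cast
  linear_combination fderiv ℝ g (ξ - (X + t • V).2) V.2 * e * Complex.I_mul_I

theorem hasDerivAt_weylCoeff (f g : 𝓢(Fin n → ℝ, ℂ)) (X V : Phase n ℝ) (t : ℝ) :
    HasDerivAt (fun t : ℝ => weylCoeff f g (X + t • V))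
      (Complex.I * weylCoeff f (fieldOp V.toComplex g) (X + t • V)
        + Complex.I / 2 * symplForm V X * weylCoeff f g (X + t • V)) t := by
  let g' (t : ℝ) : 𝓢(Fin n → ℝ, ℂ) := Complex.I • weylOp (X + t • V) (fieldOp V.toComplex g)
    + (Complex.I / 2 * symplForm V X : ℂ) • weylOp (X + t • V) g
  have hg' : ∀ t ξ, HasDerivAt (fun t : ℝ => weylOp (X + t • V) g ξ) (g' t ξ) t := fun t ξ => by
    simpa only [g', coe_weylOp_apply, add_apply, smul_apply, smul_eq_mul] using
      hasDerivAt_weyl g X V ξ t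
  obtain ⟨C, hC⟩ : ∃ C, ∀ t ξ, ‖g' t ξ‖ ≤ C := by
    obtain ⟨C₁, hC₁⟩ := exists_norm_weyl_le (fieldOp V.toComplex g)
    obtain ⟨C₂, hC₂⟩ := exists_norm_weyl_le g
    refine ⟨‖Complex.I‖ * C₁ + ‖Complex.I / 2 * symplForm V X‖ * C₂, fun t ξ => ?_⟩
    refine (norm_add_le _ _).trans ?_
    simp only [smul_apply, norm_smul, coe_weylOp_apply]
    gcongr
    exacts [hC₁ _ ξ, hC₂ _ ξ]
  have hderiv : HasDerivAt (fun t : ℝ => l2Form f (weylOp (X + t • V) g)) (l2Form f (g' t)) t :=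
    (hasDerivAt_integral_of_dominated_loc_of_deriv_le (bound := fun ξ => ‖f ξ‖ * C) Filter.univ_mem
      (Filter.Eventually.of_forall fun t => (integrable_star_mul f _).aestronglyMeasurable)
      (integrable_star_mul f _) (F' := fun t ξ => star (f ξ) * g' t ξ)
      (integrable_star_mul f _).aestronglyMeasurable
      (Filter.Eventually.of_forall fun ξ t _ => by
        rw [norm_mul, norm_star]
        exact mul_le_mul_of_nonneg_left (hC t ξ) (norm_nonneg _))
      (f.integrable.norm.mul_const C)
      (Filter.Eventually.of_forall fun ξ t _ => (hg' t ξ).const_mul _)).2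
  simpa only [g', weylCoeff, map_add, map_smul, smul_eq_mul] using hderiv

theorem norm_le_sum_norm_apply (X : Phase n ℝ) : ‖X‖ ≤ ∑ j, (‖X.1 j‖ + ‖X.2 j‖) := by
  have hnonneg : 0 ≤ ∑ j, (‖X.1 j‖ + ‖X.2 j‖) := by positivity
  have hj : ∀ j, ‖X.1 j‖ + ‖X.2 j‖ ≤ ∑ j, (‖X.1 j‖ + ‖X.2 j‖) := fun j =>
    Finset.single_le_sum (f := fun j => ‖X.1 j‖ + ‖X.2 j‖) (fun _ _ => by positivity)
      (Finset.mem_univ j)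
  refine max_le ((pi_norm_le_iff_of_nonneg hnonneg).2 fun j => ?_)
    ((pi_norm_le_iff_of_nonneg hnonneg).2 fun j => ?_)
  · linarith [hj j, norm_nonneg (X.2 j)]
  · linarith [hj j, norm_nonneg (X.1 j)]

theorem norm_mul_norm_weylCoeff_le (f g : 𝓢(Fin n → ℝ, ℂ)) (X : Phase n ℝ) :
    ‖X‖ * ‖weylCoeff f g X‖ ≤ ∑ j,
      ((‖weylCoeff (momentumOp j f) g X‖ + ‖weylCoeff f (momentumOp j g) X‖)
        + (‖weylCoeff (positionOp j f) g X‖ + ‖weylCoeff f (positionOp j g) X‖)) := by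
  calc ‖X‖ * ‖weylCoeff f g X‖
      ≤ (∑ j, (‖X.1 j‖ + ‖X.2 j‖)) * ‖weylCoeff f g X‖ := by
        gcongr
        exact norm_le_sum_norm_apply X
    _ = ∑ j, (‖(X.1 j : ℂ) * weylCoeff f g X‖ + ‖(X.2 j : ℂ) * weylCoeff f g X‖) := by
        simp only [Finset.sum_mul, add_mul, norm_mul, Complex.norm_real]
    _ ≤ _ := by
        simp only [fst_mul_weylCoeff, snd_mul_weylCoeff]
        gcongr <;> exact norm_sub_le _ _

theorem exists_pow_norm_mul_norm_weylCoeff_le (N : ℕ) (f g : 𝓢(Fin n → ℝ, ℂ)) :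
    ∃ C, ∀ X, ‖X‖ ^ N * ‖weylCoeff f g X‖ ≤ C := by
  induction N generalizing f g with
  | zero => simpa using exists_norm_weylCoeff_le f g
  | succ N ih =>
    choose C hC using ih
    refine ⟨∑ j, ((C (momentumOp j f) g + C f (momentumOp j g))
      + (C (positionOp j f) g + C f (positionOp j g))), fun X => ?_⟩
    rw [pow_succ, mul_assoc]
    refine (mul_le_mul_of_nonneg_left (norm_mul_norm_weylCoeff_le f g X) (by positivity)).trans ?_
    simp only [Finset.mul_sum, mul_add]
    gcongr <;> exact hC _ _ X

theorem integrable_weylCoeff (L : Submodule ℝ (Phase n ℝ)) (μ : Measure L) [μ.IsAddHaarMeasure]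
    (f g : 𝓢(Fin n → ℝ, ℂ)) : Integrable (fun X : L => weylCoeff f g X) μ := by
  obtain ⟨C₁, hC₁⟩ := exists_norm_weylCoeff_le f g
  obtain ⟨C₂, hC₂⟩ := exists_pow_norm_mul_norm_weylCoeff_le (0 + μ.integrablePower) f g
  have hmeas : AEStronglyMeasurable (fun X : L => weylCoeff f g X) μ :=
    ((continuous_weylCoeff f g).comp continuous_subtype_val).aestronglyMeasurable
  have hnorm := integrable_of_le_of_pow_mul_le (k := 0) (fun X : L => hC₁ X) (fun X => hC₂ X) hmeas
  simpa only [pow_zero, one_mul, integrable_norm_iff hmeas] using hnorm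

end WeylCoefficients

section ConstraintForm

open scoped SchwartzMap ComplexOrder
open MeasureTheory

variable {n : ℕ} {L : Submodule ℝ (Phase n ℝ)} (μ : Measure L) [μ.IsAddHaarMeasure]

/-- The inner product `constraintInner` as a sesquilinear form on the Schwartz space. -/
noncomputable def constraintForm : 𝓢(Fin n → ℝ, ℂ) →ₗ⋆[ℂ] 𝓢(Fin n → ℝ, ℂ) →ₗ[ℂ] ℂ :=
  LinearMap.mk₂'ₛₗ _ _ (fun f g => ∫ X : L, weylCoeff f g X ∂μ)
    (fun f f' g => by
      rw [← integral_add (integrable_weylCoeff L μ f g) (integrable_weylCoeff L μ f' g)]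
      simp only [weylCoeff, map_add, LinearMap.add_apply])
    (fun c f g => by
      simp only [weylCoeff, map_smulₛₗ, LinearMap.smul_apply, integral_smul])
    (fun f g g' => by
      rw [← integral_add (integrable_weylCoeff L μ f g) (integrable_weylCoeff L μ f g')]
      simp only [weylCoeff, map_add])
    (fun c f g => by simp only [weylCoeff, map_smul, integral_smul, RingHom.id_apply])

theorem constraintForm_apply (f g : 𝓢(Fin n → ℝ, ℂ)) :
    constraintForm μ f g = ∫ X : L, weylCoeff f g X ∂μ := rfl

theorem constraintInner_eq_constraintForm (f g : 𝓢(Fin n → ℝ, ℂ)) :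
    constraintInner L μ f g = constraintForm μ f g := by
  simp only [constraintInner, constraintForm_apply, weylCoeff_apply]

theorem integral_lineDeriv_eq_zero {V : Type*} [NormedAddCommGroup V] [NormedSpace ℝ V]
    [FiniteDimensional ℝ V] [MeasurableSpace V] [BorelSpace V] {μ : Measure V}
    [μ.IsAddHaarMeasure] {F F' : V → ℂ} (v : V) (hF : Integrable F μ) (hF' : Integrable F' μ)
    (hderiv : ∀ x, HasLineDerivAt ℝ F (F' x) x v) : ∫ x, F' x ∂μ = 0 := by
  have hparts := integral_bilinear_hasLineDerivAt_right_eq_neg_left_of_integrable (μ := μ)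
    (B := ContinuousLinearMap.mul ℝ ℂ) (f := fun _ => 1) (f' := fun _ => 0) (g := F) (g' := F')
    (v := v) (by simp) (by simpa using hF') (by simpa using hF)
    (fun _ _ => hasDerivAt_const (0 : ℝ) (1 : ℂ)) (fun x _ => hderiv x)
  simpa using hparts

theorem constraintForm_fieldOp_toComplex (hL : ∀ X ∈ L, ∀ X' ∈ L, symplForm X X' = 0)
    {V : Phase n ℝ} (hV : V ∈ L) (f g : 𝓢(Fin n → ℝ, ℂ)) :
    constraintForm μ f (fieldOp V.toComplex g) = 0 := by
  have hint : ∫ X : L, Complex.I * weylCoeff f (fieldOp V.toComplex g) X ∂μ = 0 := by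
    refine integral_lineDeriv_eq_zero (⟨V, hV⟩ : L) (integrable_weylCoeff L μ f g)
      ((integrable_weylCoeff L μ f _).const_mul _) fun X => ?_
    simpa [HasLineDerivAt, hL V hV X X.2] using hasDerivAt_weylCoeff f g X V 0
  rwa [integral_const_mul, mul_eq_zero_iff_left Complex.I_ne_zero] at hint

theorem constraintForm_fieldOp_right (hL : ∀ X ∈ L, ∀ X' ∈ L, symplForm X X' = 0)
    {X : Phase n ℂ} (hX : X ∈ complexify L) (f g : 𝓢(Fin n → ℝ, ℂ)) :
    constraintForm μ f (fieldOp X g) = 0 := by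
  suffices hle : complexify L ≤ LinearMap.ker (constraintForm μ f ∘ₗ fieldOp.flip g) from hle hX
  refine Submodule.span_le.2 ?_
  rintro _ ⟨V, hV, rfl⟩
  exact constraintForm_fieldOp_toComplex μ hL hV f g

theorem constraintForm_fieldOp_left {Y : Phase n ℂ} (hY : Y ∈ skewOrth (complexify L))
    (f g : 𝓢(Fin n → ℝ, ℂ)) :
    constraintForm μ (fieldOp Y f) g = constraintForm μ f (fieldOp (star Y) g) := by
  have hzero : ∀ X : L, symplForm (star Y) (X : Phase n ℝ).toComplex = 0 := fun X => by
    rw [← star_toComplex, ← symplBilin_apply, ← star_symplBilin, symplBilin_apply,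
      hY _ (toComplex_mem_complexify X.2), star_zero]
  simp only [constraintForm_apply, weylCoeff_fieldOp_left, hzero, zero_mul, add_zero]

theorem constraintForm_fieldOp_star_self {W : Phase n ℂ} (hW : W ∈ skewOrth (complexify L))
    {ψ : 𝓢(Fin n → ℝ, ℂ)} (hψ : fieldOp W ψ = 0) :
    constraintForm μ (fieldOp (star W) ψ) (fieldOp (star W) ψ)
      = (1 / Complex.I) * symplForm W (star W) * constraintForm μ ψ ψ := by
  rw [constraintForm_fieldOp_left μ (star_mem_skewOrth_complexify hW), star_star, fieldOp_comm, hψ,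
    map_zero, zero_add, map_smul, smul_eq_mul]

theorem constraintForm_fieldOp_add_star_self (hL : ∀ X ∈ L, ∀ X' ∈ L, symplForm X X' = 0)
    {X W : Phase n ℂ} (hX : X ∈ complexify L) (hXorth : X ∈ skewOrth (complexify L))
    (hW : W ∈ skewOrth (complexify L)) {ψ : 𝓢(Fin n → ℝ, ℂ)} (hψ : fieldOp W ψ = 0) :
    constraintForm μ (fieldOp (X + star W) ψ) (fieldOp (X + star W) ψ)
      = (1 / Complex.I) * symplForm W (star W) * constraintForm μ ψ ψ := by
  rw [← constraintForm_fieldOp_star_self μ hW hψ, map_add, LinearMap.add_apply, map_add,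
    constraintForm_fieldOp_right μ hL hX, zero_add, map_add, LinearMap.add_apply,
    constraintForm_fieldOp_left μ hXorth,
    constraintForm_fieldOp_right μ hL (star_mem_complexify hX), zero_add]

theorem exists_fieldOp_eq_fieldOp_add_star {r : Submodule ℂ (Phase n ℂ)} (hCr : complexify L ≤ r)
    (hsup : skewOrth (complexify L) = r ⊔ conjSubspace r) {ψ : 𝓢(Fin n → ℝ, ℂ)}
    (hψ : r ≤ complexify L ⊔ LinearMap.ker (fieldOp.flip ψ)) {Y : Phase n ℂ}
    (hY : Y ∈ skewOrth (complexify L)) :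
    ∃ X ∈ complexify L, ∃ W ∈ r, fieldOp W ψ = 0 ∧ fieldOp Y ψ = fieldOp (X + star W) ψ ∧
      Y - star W ∈ r := by
  obtain ⟨a, ha, b, hb, rfl⟩ := Submodule.mem_sup.1 (hsup ▸ hY)
  obtain ⟨X₁, hX₁, W₁, hW₁, rfl⟩ := Submodule.mem_sup.1 (hψ ha)
  obtain ⟨X₂, hX₂, W₂, hW₂, hXW⟩ := Submodule.mem_sup.1 (hψ hb)
  have hW₁ψ : fieldOp W₁ ψ = 0 := hW₁
  have hb_eq : b = star X₂ + star W₂ := by rw [← star_add, hXW, star_star]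
  have hW₂r : W₂ ∈ r := (Submodule.add_mem_iff_right _ (hCr hX₂)).1 (hXW ▸ hb)
  refine ⟨X₁ + star X₂, add_mem hX₁ (star_mem_complexify hX₂), W₂, hW₂r, hW₂, ?_, ?_⟩
  · rw [add_right_comm, map_add, LinearMap.add_apply, hW₁ψ, add_zero, hb_eq, add_assoc]
  · rw [hb_eq, ← add_assoc, add_sub_cancel_right]
    exact r.add_mem ha (hCr (star_mem_complexify hX₂))

theorem hGerm_eq_of_le_sup_ker (hL : ∀ X ∈ L, ∀ X' ∈ L, symplForm X X' = 0)
    {r : Submodule ℂ (Phase n ℂ)} (hr : IsLagrangian r) (hCr : complexify L ≤ r)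
    (hpos : ∀ Y ∈ r, Y ∉ complexify L → 0 < (1 / Complex.I) * symplForm Y (star Y))
    {ψ : 𝓢(Fin n → ℝ, ℂ)} (hψ : r ≤ complexify L ⊔ LinearMap.ker (fieldOp.flip ψ))
    (hnorm : constraintForm μ ψ ψ ≠ 0) : hGerm L μ ψ = r := by
  have hsup : skewOrth (complexify L) = r ⊔ conjSubspace r :=
    hr.inf_conjSubspace_eq_complexify hCr hpos ▸ hr.skewOrth_inf_conjSubspace
  have hrorth : r ≤ skewOrth (complexify L) := hsup ▸ le_sup_left
  ext Y
  simp only [hGerm, ← coe_fieldOp_apply, constraintInner_eq_constraintForm, Set.mem_ofPred_eq,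
    SetLike.mem_coe]
  refine ⟨fun ⟨hY, hY0⟩ => ?_, fun hY => ⟨hrorth hY, ?_⟩⟩
  · obtain ⟨X, hX, W, hW, hWψ, hYψ, hYr⟩ := exists_fieldOp_eq_fieldOp_add_star hCr hsup hψ hY
    rw [hYψ, constraintForm_fieldOp_add_star_self μ hL hX (hrorth (hCr hX)) (hrorth hW) hWψ,
      mul_eq_zero_iff_right hnorm] at hY0
    have hWC : W ∈ complexify L := by
      by_contra hne
      exact (hpos W hW hne).ne' hY0
    exact (Submodule.sub_mem_iff_left r (hCr (star_mem_complexify hWC))).1 hYr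
  · obtain ⟨X, hX, W, hW, rfl⟩ := Submodule.mem_sup.1 (hψ hY)
    have hWψ : fieldOp W ψ = 0 := hW
    rw [map_add, LinearMap.add_apply, hWψ, add_zero, constraintForm_fieldOp_right μ hL hX]

end ConstraintForm

section Positivity

open scoped SchwartzMap ComplexOrder
open MeasureTheory

variable {n : ℕ}

theorem integral_pos_of_continuous_of_nonneg {V : Type*} [TopologicalSpace V] [MeasurableSpace V]
    {μ : Measure V} [μ.IsOpenPosMeasure] {F : V → ℂ} (hcont : Continuous F)
    (hint : Integrable F μ) (hnonneg : ∀ x, 0 ≤ F x) {x : V} (hx : F x ≠ 0) :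
    0 < ∫ x, F x ∂μ := by
  have hre : ∀ x, ((F x).re : ℂ) = F x := fun x =>
    (Complex.eq_re_of_ofReal_le (r := 0) (by simpa using hnonneg x)).symm
  have hpos : 0 < ∫ x, (F x).re ∂μ :=
    integral_pos_of_integrable_nonneg_nonzero (Complex.continuous_re.comp hcont) hint.re
      (fun x => (Complex.le_def.1 (hnonneg x)).1)
      fun h0 => hx (by rw [← hre, h0, Complex.ofReal_zero])
  rw [← integral_congr_ae (Filter.Eventually.of_forall hre), integral_complex_ofReal]
  exact_mod_cast hpos

theorem l2Form_self_pos {ψ : 𝓢(Fin n → ℝ, ℂ)} (hψ : ψ ≠ 0) : 0 < l2Form ψ ψ := by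
  obtain ⟨ξ, hξ⟩ := DFunLike.ne_iff.1 hψ
  exact integral_pos_of_continuous_of_nonneg (by fun_prop) (integrable_star_mul ψ ψ)
    (fun ξ => star_mul_self_nonneg (ψ ξ)) (x := ξ) (mul_ne_zero (star_ne_zero.2 hξ) hξ)

theorem weylCoeff_zero (f g : 𝓢(Fin n → ℝ, ℂ)) : weylCoeff f g 0 = l2Form f g := by
  simp [weylCoeff_apply, l2Form_apply, weyl]

theorem hasDerivAt_weylCoeff_smul {ψ : 𝓢(Fin n → ℝ, ℂ)} {X : Phase n ℝ} {b : Phase n ℂ}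
    (hX : X.toComplex = b + star b) (hψ : fieldOp b ψ = 0) (t : ℝ) :
    HasDerivAt (fun t : ℝ => weylCoeff ψ ψ (t • X))
      (Complex.I * symplForm b (star b) * t * weylCoeff ψ ψ (t • X)) t := by
  have hform : symplForm (star b) (t • X).toComplex = -(t * symplForm b (star b)) := by
    rw [toComplex_smul, symplForm_smul_right, hX, ← symplBilin_apply, map_add, symplBilin_swap,
      symplBilin_apply, symplBilin_apply, symplForm_self, add_zero, mul_neg]
  have hadj : weylCoeff ψ (fieldOp (star b) ψ) (t • X)
      = t * symplForm b (star b) * weylCoeff ψ ψ (t • X) := by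
    have hleft := weylCoeff_fieldOp_left b ψ ψ (t • X)
    rw [hψ, hform, weylCoeff, map_zero, LinearMap.zero_apply] at hleft
    linear_combination -hleft
  have hderiv := hasDerivAt_weylCoeff ψ ψ 0 X t
  simp only [zero_add, hX, map_add, LinearMap.add_apply, hψ, hadj] at hderiv
  have hzero : symplForm X 0 = 0 := by simp [symplForm]
  refine hderiv.congr_deriv ?_
  rw [hzero, Complex.ofReal_zero]
  ring

theorem weylCoeff_self_eq {ψ : 𝓢(Fin n → ℝ, ℂ)} {X : Phase n ℝ} {b : Phase n ℂ}
    (hX : X.toComplex = b + star b) (hψ : fieldOp b ψ = 0) :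
    weylCoeff ψ ψ X = Complex.exp (Complex.I * symplForm b (star b) / 2) * l2Form ψ ψ := by
  set z := Complex.I * symplForm b (star b)
  let φ (t : ℝ) : ℂ := Complex.exp (-(z / 2 * t ^ 2)) * weylCoeff ψ ψ (t • X)
  have hφ : ∀ t, HasDerivAt φ 0 t := fun t => by
    have hexp : HasDerivAt (fun t : ℝ => Complex.exp (-(z / 2 * (t : ℂ) ^ 2)))
        (Complex.exp (-(z / 2 * t ^ 2)) * -(z / 2 * (2 * t))) t := by
      simpa using (((hasDerivAt_id t).ofReal_comp.pow 2).const_mul (z / 2)).neg.cexp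
    exact (hexp.mul (hasDerivAt_weylCoeff_smul hX hψ t)).congr_deriv (by ring)
  have hconst : φ 1 = φ 0 :=
    is_const_of_deriv_eq_zero (fun t => (hφ t).differentiableAt) (fun t => (hφ t).deriv) 1 0
  simp only [φ, Complex.ofReal_one, one_pow, mul_one, one_smul, Complex.ofReal_zero, zero_smul,
    weylCoeff_zero] at hconst
  rw [← one_mul (weylCoeff ψ ψ X), ← Complex.exp_zero, ← add_neg_cancel (z / 2), Complex.exp_add,
    mul_assoc, hconst]
  simp

theorem weylCoeff_self_pos {ψ : 𝓢(Fin n → ℝ, ℂ)} (hne : ψ ≠ 0) {X : Phase n ℝ} {b : Phase n ℂ}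
    (hX : X.toComplex = b + star b) (hψ : fieldOp b ψ = 0) : 0 < weylCoeff ψ ψ X := by
  have hconj : star (symplForm b (star b)) = -symplForm b (star b) := by
    rw [← symplBilin_apply, star_symplBilin, star_star, symplBilin_swap]
  obtain ⟨s, hs⟩ : ∃ s : ℝ, Complex.I * symplForm b (star b) / 2 = s :=
    Complex.conj_eq_iff_real.1 (by
      rw [map_div₀, map_mul, Complex.conj_I, Complex.conj_ofNat, ← Complex.star_def, hconj,
        neg_mul_neg])
  rw [weylCoeff_self_eq hX hψ, hs, ← Complex.ofReal_exp]
  exact mul_pos (by exact_mod_cast Real.exp_pos _) (l2Form_self_pos hne)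

theorem constraintForm_self_pos {L : Submodule ℝ (Phase n ℝ)} (μ : Measure L) [μ.IsAddHaarMeasure]
    {ψ : 𝓢(Fin n → ℝ, ℂ)} (hne : ψ ≠ 0) {R : Submodule ℂ (Phase n ℂ)}
    (hR : R ⊔ conjSubspace R = ⊤) (hψ : R ≤ LinearMap.ker (fieldOp.flip ψ)) :
    0 < constraintForm μ ψ ψ := by
  have hpos : ∀ X, 0 < weylCoeff ψ ψ X := fun X => by
    obtain ⟨b, hb, hX⟩ := exists_add_star_eq_toComplex hR X
    exact weylCoeff_self_pos hne hX (hψ hb)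
  exact integral_pos_of_continuous_of_nonneg
    ((continuous_weylCoeff ψ ψ).comp continuous_subtype_val)
    (integrable_weylCoeff L μ ψ ψ) (fun X => (hpos X).le) (x := 0) (hpos _).ne'

end Positivity

section GaussianStates

open scoped SchwartzMap Matrix

theorem exists_mul_norm_sq_le {V : Type*} [NormedAddCommGroup V] [NormedSpace ℝ V]
    [FiniteDimensional ℝ V] {q : V → ℝ} (hcont : Continuous q)
    (hsmul : ∀ (t : ℝ) x, q (t • x) = t ^ 2 * q x) (hpos : ∀ x ≠ 0, 0 < q x) :
    ∃ ε > 0, ∀ x, ε * ‖x‖ ^ 2 ≤ q x := by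
  rcases subsingleton_or_nontrivial V with hV | hV
  · refine ⟨1, one_pos, fun x => ?_⟩
    have h0 : q 0 = 0 := by simpa using hsmul 0 0
    simp [Subsingleton.elim x 0, h0]
  obtain ⟨x₀, hx₀, hmin⟩ := (isCompact_sphere (0 : V) 1).exists_isMinOn
    (NormedSpace.sphere_nonempty.2 zero_le_one) hcont.continuousOn
  refine ⟨q x₀, hpos x₀ (ne_zero_of_mem_unit_sphere ⟨x₀, hx₀⟩), fun x => ?_⟩
  rcases eq_or_ne x 0 with rfl | hx
  · simpa using (hsmul 0 0).ge
  · have hunit : ‖x‖⁻¹ • x ∈ Metric.sphere (0 : V) 1 := by simp [norm_smul, hx]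
    have hnorm : ‖x‖ ≠ 0 := norm_ne_zero_iff.2 hx
    calc q x₀ * ‖x‖ ^ 2 ≤ q (‖x‖⁻¹ • x) * ‖x‖ ^ 2 := by
          gcongr
          exact hmin hunit
      _ = q x := by
          rw [hsmul]
          field_simp

variable {n : ℕ} {A : Matrix (Fin n) (Fin n) ℂ}

theorem exists_schwartz_eq_gaussian (hA : (A.map Complex.im).PosDef) (c : ℂ) :
    ∃ ψ : 𝓢(Fin n → ℝ, ℂ), ∀ ξ, ψ ξ = gaussian A c ξ := by
  obtain ⟨ε, hε, hle⟩ := exists_mul_norm_sq_le (q := fun ξ => ξ ⬝ᵥ A.map Complex.im *ᵥ ξ)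
    (by fun_prop) (fun t ξ => by simp [Matrix.mulVec_smul, pow_two, mul_assoc])
    (fun ξ hξ => by simpa using hA.dotProduct_mulVec_pos hξ)
  have hgrowth : (fun ξ : Fin n → ℝ =>
      (Complex.I / 2) * ∑ j, ∑ k, (ξ j : ℂ) * A j k * (ξ k : ℂ)).HasTemperateGrowth :=
    (Function.HasTemperateGrowth.const _).mul (.sum fun j _ => .sum fun k _ =>
      ((hasTemperateGrowth_ofReal_eval j).mul (.const _)).mul (hasTemperateGrowth_ofReal_eval k))
  obtain ⟨g, hg⟩ := exists_schwartz_cexp (C := 1 / (2 * ε)) hgrowth fun ξ => by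
    have hre : ((Complex.I / 2) * ∑ j, ∑ k, (ξ j : ℂ) * A j k * (ξ k : ℂ)).re
        = -(1 / 2) * (ξ ⬝ᵥ A.map Complex.im *ᵥ ξ) := by
      simp [dotProduct, Matrix.mulVec, Finset.mul_sum, mul_assoc]
    have hsq : 1 / (2 * ε) - ‖ξ‖ + ε * ‖ξ‖ ^ 2 / 2 = (ε * ‖ξ‖ - 1) ^ 2 / (2 * ε) := by
      field_simp
      ring
    have hsq_nonneg : 0 ≤ (ε * ‖ξ‖ - 1) ^ 2 / (2 * ε) := by positivity
    rw [hre]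
    linarith [hle ξ]
  exact ⟨c • g, fun ξ => by rw [smul_apply, hg, smul_eq_mul, gaussian]⟩

theorem dotProduct_mulVec_comm {ι R : Type*} [Fintype ι] [CommSemiring R] {A : Matrix ι ι R}
    (hA : A.IsSymm) (u v : ι → R) : u ⬝ᵥ A *ᵥ v = v ⬝ᵥ A *ᵥ u := by
  rw [Matrix.dotProduct_mulVec, ← Matrix.mulVec_transpose, hA.eq, dotProduct_comm]

theorem fderiv_gaussian (hA : A.IsSymm) (c : ℂ) (ξ v : Fin n → ℝ) :
    fderiv ℝ (gaussian A c) ξ v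
      = Complex.I * ((Complex.ofReal ∘ v) ⬝ᵥ A *ᵥ (Complex.ofReal ∘ ξ)) * gaussian A c ξ := by
  have hcoord : ∀ j, HasFDerivAt (fun ξ : Fin n → ℝ => (ξ j : ℂ))
      (Complex.ofRealCLM ∘L ContinuousLinearMap.proj j) ξ := fun j =>
    Complex.ofRealCLM.hasFDerivAt.comp ξ (hasFDerivAt_apply j ξ)
  have hphase : HasFDerivAt (fun ξ : Fin n → ℝ => ∑ j, ∑ k, (ξ j : ℂ) * A j k * (ξ k : ℂ)) _ ξ :=
    HasFDerivAt.fun_sum fun j _ => HasFDerivAt.fun_sum fun k _ =>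
      ((hcoord j).mul_const (A j k)).mul (hcoord k)
  have hgauss : HasFDerivAt (gaussian A c) _ ξ :=
    ((hphase.const_mul (Complex.I / 2)).cexp).const_mul c
  have hsum : ∑ j, ∑ k, ((ξ j : ℂ) * A j k * v k + ξ k * (A j k * v j))
      = 2 * ((Complex.ofReal ∘ v) ⬝ᵥ A *ᵥ (Complex.ofReal ∘ ξ)) := by
    have hcomm := dotProduct_mulVec_comm hA (Complex.ofReal ∘ ξ) (Complex.ofReal ∘ v)
    rw [two_mul]
    nth_rewrite 1 [← hcomm]
    simp only [dotProduct, Matrix.mulVec, Function.comp_apply, Finset.mul_sum,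
      ← Finset.sum_add_distrib]
    exact Finset.sum_congr rfl fun j _ => Finset.sum_congr rfl fun k _ => by ring
  rw [hgauss.fderiv]
  simp only [smul_apply, sum_apply, add_apply, smul_eq_mul,
    ContinuousLinearMap.comp_apply, Complex.ofRealCLM_apply, ContinuousLinearMap.proj_apply, hsum,
    gaussian]
  ring

theorem OmegaOp_gaussian (hA : A.IsSymm) (c : ℂ) {Y : Phase n ℂ} (hY : Y ∈ matrixGraph A) :
    OmegaOp Y (gaussian A c) = 0 := by
  ext ξ
  have hsingle : ∀ j, Complex.ofReal ∘ Pi.single j 1 = (Pi.single j 1 : Fin n → ℂ) := fun j => by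
    ext k
    simp [Pi.single_apply, apply_ite]
  have hpartial : ∀ j, fderiv ℝ (gaussian A c) ξ (Pi.single j 1)
      = Complex.I * (A *ᵥ (Complex.ofReal ∘ ξ)) j * gaussian A c ξ := fun j => by
    rw [fderiv_gaussian hA, hsingle, single_one_dotProduct]
  have hY1 : Y.1 ⬝ᵥ (Complex.ofReal ∘ ξ) = Y.2 ⬝ᵥ A *ᵥ (Complex.ofReal ∘ ξ) := by
    rw [mem_matrixGraph.1 hY, dotProduct_comm, dotProduct_mulVec_comm hA]
  calc OmegaOp Y (gaussian A c) ξ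
      = (Y.1 ⬝ᵥ (Complex.ofReal ∘ ξ) - Y.2 ⬝ᵥ A *ᵥ (Complex.ofReal ∘ ξ)) * gaussian A c ξ := by
        simp only [OmegaOp, hpartial, dotProduct, ← Finset.sum_sub_distrib, Finset.sum_mul,
          Function.comp_apply]
        refine Finset.sum_congr rfl fun j _ => ?_
        field_simp
    _ = 0 := by rw [hY1, sub_self, zero_mul]

theorem matrixGraph_le_ker_fieldOp (hA : A.IsSymm) {c : ℂ} {ψ : 𝓢(Fin n → ℝ, ℂ)}
    (hψ : ∀ ξ, ψ ξ = gaussian A c ξ) : matrixGraph A ≤ LinearMap.ker (fieldOp.flip ψ) := by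
  intro Y hY
  rw [LinearMap.mem_ker, LinearMap.flip_apply]
  ext ξ
  rw [coe_fieldOp_apply, show ⇑ψ = gaussian A c from funext hψ, OmegaOp_gaussian hA c hY]
  rfl

theorem ne_zero_of_eq_gaussian {c : ℂ} (hc : c ≠ 0) {ψ : 𝓢(Fin n → ℝ, ℂ)}
    (hψ : ∀ ξ, ψ ξ = gaussian A c ξ) : ψ ≠ 0 := by
  rintro rfl
  exact mul_ne_zero hc (Complex.exp_ne_zero _) (hψ 0).symm

end GaussianStates

open scoped SchwartzMap ComplexOrder in
theorem lemma12 {n k : ℕ}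
    (L : Submodule ℝ (Phase n ℝ))
    (hk : Module.finrank ℝ L = k)
    (hL : ∀ X ∈ L, ∀ X' ∈ L, symplForm X X' = 0)
    (μ : MeasureTheory.Measure L) [μ.IsAddHaarMeasure]
    (r : Submodule ℂ (Phase n ℂ))
    (hdim : Module.finrank ℂ r = n)
    (hiso : ∀ Y₁ ∈ r, ∀ Y₂ ∈ r, symplForm Y₁ Y₂ = 0)
    (hLr : ∀ Y ∈ complexify L, Y ∈ r ∧ symplForm Y (star Y) = 0)
    (hpos : ∀ Y ∈ r, Y ∉ complexify L → 0 < (1 / Complex.I) * symplForm Y (star Y)) :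
    skewOrth (complexify L) = r ⊔ conjSubspace r ∧
    r ⊓ conjSubspace r = complexify L ∧
    ∃ A : Matrix (Fin n) (Fin n) ℂ, A.IsSymm ∧ (A.map Complex.im).PosDef ∧
      ∀ c : ℂ, c ≠ 0 → ∃ ψ : 𝓢(Fin n → ℝ, ℂ),
        (∀ ξ, ψ ξ = gaussian A c ξ) ∧ hGerm L μ ψ = (r : Set (Phase n ℂ)) := by
  have hr : IsLagrangian r := isLagrangian_of_finrank_eq hdim hiso
  have hCr : complexify L ≤ r := fun Y hY => (hLr Y hY).1
  have hinf : r ⊓ conjSubspace r = complexify L := hr.inf_conjSubspace_eq_complexify hCr hpos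
  obtain ⟨R, hR, hRpos, hrR⟩ :=
    exists_isLagrangian_isPositive hr hCr (fun _ => star_mem_complexify) hpos
  obtain ⟨A, hA, hAim, rfl⟩ := exists_matrix_of_isPositive hR hRpos
  refine ⟨hinf ▸ hr.skewOrth_inf_conjSubspace, hinf, A, hA, hAim, fun c hc => ?_⟩
  obtain ⟨ψ, hψ⟩ := exists_schwartz_eq_gaussian hAim c
  have hker : matrixGraph A ≤ LinearMap.ker (fieldOp.flip ψ) := matrixGraph_le_ker_fieldOp hA hψ
  have hnorm : 0 < constraintForm μ ψ ψ := constraintForm_self_pos μ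
    (ne_zero_of_eq_gaussian hc hψ) (hR.sup_conjSubspace_eq_top hRpos) hker
  exact ⟨ψ, hψ, hGerm_eq_of_le_sup_ker μ hL hr hCr hpos (hrR.trans (sup_le_sup_left hker _))
    hnorm.ne'⟩
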